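/- Let $p_0=(0,0)$, $p_1=(\frac12,0)$, $p_2=(1,0)$, $p_3=(1,\frac12)$, $p_4=(1,1)$, $p_5=(\frac12,1)$, $p_6=(0,1)$, $p_7=(0,\frac12)$ in $\mathbb{R}^2$, let $f_i(x)=(x+2p_i)/3$ for $i=0,\dots,7$, and let $K$ be the Sierpiński carpet, i.e. the unique non-empty compact set with $K=\bigcup_{i=0}^7 f_i(K)$. Let $V_0=\{p_0,\dots,p_7\}$, $V_{n+1}=\bigcup_{i=0}^7 f_i(V_n)$, and let $W_n=\{0,\dots,7\}^n$ be the set of words of length $n$. For $w=w_1\dots w_n\in W_n$ put $f_w=f_{w_1}\circ\dots\circ f_{w_n}$, $V_w=f_w(V_0)$, $K_w=f_w(K)$; write $i^n$ for the word $i\dots i$ of length $n$. For $u:V_n\to\mathbb{R}$ let $$D_n(u,u)=\sum_{w\in W_n}\ \sum_{\substack{p,q\in V_w\\ |p-q|=2^{-1}\cdot 3^{-n}}}(u(p)-u(q))^2,$$ and for $u:W_n\to\mathbb{R}$ let $$\mathfrak{D}_n(u,u)=\sum_{w^{(1)}\sim_n w^{(2)}}\bigl(u(w^{(1)})-u(w^{(2)})\bigr)^2,$$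 where $w^{(1)}\sim_n w^{(2)}$ means $\dim_{\mathcal H}(K_{w^{(1)}}\cap K_{w^{(2)}})=1$; the sums over $p,q$ and over $w^{(1)}\sim_n w^{(2)}$ run over unordered pairs. For disjoint $A,B\subseteq V_n$ let $$R_n(A,B)=\Bigl(\inf\{D_n(u,u):u|_A=0,\ u|_B=1\}\Bigr)^{-1}\in[0,\infty],$$ and let $\mathfrak{R}_n(A,B)$ be defined in the same way from $\mathfrak{D}_n$ for disjoint $A,B\subseteq W_n$. Write $R_n(x,y)=R_n(\{x\},\{y\})$ and $\mathfrak{R}_n(x,y)=\mathfrak{R}_n(\{x\},\{y\})$ for $x\neq y$, $R_n(x,x)=\mathfrak{R}_n(x,x)=0$, and $$R_n^V=R_n\bigl(V_n\cap(\{0\}\times[0,1]),\ V_n\cap(\{1\}\times[0,1])\bigr).$$ Theorem. There exist $\rho\in[7/6,3/2]$ and a constant $C>0$ such that for all $n\ge1$: 1. $C^{-1}\rho^n\le R_n^V\le C\rho^n$; 2. $R_n(p_0,p_1)=R_n(p_1,p_2)=\dots=R_n(p_6,p_7)=R_n(p_7,p_0)$, and this common value lies in $[C^{-1}\rho^n,C\rho^n]$;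 3. $\mathfrak{R}_n(0^n,1^n)=\mathfrak{R}_n(1^n,2^n)=\dots=\mathfrak{R}_n(6^n,7^n)=\mathfrak{R}_n(7^n,0^n)$, and this common value lies in $[C^{-1}\rho^n,C\rho^n]$; 4. $R_n(p,q)\le C\rho^n$ for all $p,q\in V_n$, and $\mathfrak{R}_n(w^{(1)},w^{(2)})\le C\rho^n$ for all $w^{(1)},w^{(2)}\in W_n$. -/

import Mathlib

open scoped ENNReal

/-- The Euclidean plane `ℝ²`. -/
abbrev Plane : Type := EuclideanSpace ℝ (Fin 2)

namespace SC

/-- The points `p_0, …, p_7`: the corners and the midpoints of the sides of the unit square. -/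
noncomputable def pt : Fin 8 → Plane :=
  ![!₂[0, 0], !₂[1 / 2, 0], !₂[1, 0], !₂[1, 1 / 2],
    !₂[1, 1], !₂[1 / 2, 1], !₂[0, 1], !₂[0, 1 / 2]]

/-- The contraction `f_i(x) = (x + 2 p_i) / 3`. -/
noncomputable def f (i : Fin 8) (x : Plane) : Plane := (3⁻¹ : ℝ) • (x + (2 : ℝ) • pt i)

/-- The defining property of the Sierpiński carpet:
a non-empty compact set `K` with `K = ⋃ i, f_i(K)`. -/
def IsCarpet (K : Set Plane) : Prop :=
  K.Nonempty ∧ IsCompact K ∧ K = ⋃ i : Fin 8, f i '' K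

theorem dist_f (i : Fin 8) (x y : Plane) : dist (f i x) (f i y) = 3⁻¹ * dist x y := by
  simp [f, dist_smul₀]

theorem IsCarpet.subset {K L : Set Plane} (hK : IsCarpet K) (hL : IsCarpet L) : K ⊆ L := by
  obtain ⟨hKn, hKc, hKs⟩ := hK
  obtain ⟨hLn, hLc, hLs⟩ := hL
  obtain ⟨x, hx, hmax⟩ := hKc.exists_isMaxOn hKn (Metric.continuous_infDist_pt L).continuousOn
  have hzero : Metric.infDist x L ≤ 0 := by
    obtain ⟨i, y, hy, rfl⟩ : ∃ i, ∃ y ∈ K, f i y = x := by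
      have h := hx
      rw [hKs] at h
      simpa using h
    obtain ⟨z, hz, hzd⟩ := hLc.exists_infDist_eq_dist hLn y
    have hz' : f i z ∈ L := by
      rw [hLs]
      exact Set.mem_iUnion.2 ⟨i, z, hz, rfl⟩
    have h1 : Metric.infDist (f i y) L ≤ 3⁻¹ * Metric.infDist y L := by
      rw [hzd, ← dist_f i]
      exact Metric.infDist_le_dist_of_mem hz'
    have h2 : Metric.infDist y L ≤ Metric.infDist (f i y) L := hmax hy
    have h3 : 0 ≤ Metric.infDist y L := Metric.infDist_nonneg
    linarith
  intro y hy
  rw [hLc.isClosed.mem_iff_infDist_zero hLn]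
  exact le_antisymm ((hmax hy).trans hzero) Metric.infDist_nonneg

theorem exists_isCarpet : ∃ K : Set Plane, IsCarpet K := by
  let t : (ℕ → Fin 8) → ℕ → Plane := fun a k => ((3⁻¹ : ℝ) ^ (k + 1) * 2) • pt (a k)
  let M : ℝ := ∑ i, ‖pt i‖
  have hM : ∀ i, ‖pt i‖ ≤ M := fun i =>
    Finset.single_le_sum (f := fun i => ‖pt i‖) (fun _ _ => norm_nonneg _) (Finset.mem_univ i)
  have hbound : ∀ k a, ‖t a k‖ ≤ ((3⁻¹ : ℝ) ^ (k + 1) * 2) * M := by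
    intro k a
    simp only [t, norm_smul]
    rw [Real.norm_of_nonneg (by positivity)]
    exact mul_le_mul_of_nonneg_left (hM _) (by positivity)
  have hsum : Summable fun k : ℕ => ((3⁻¹ : ℝ) ^ (k + 1) * 2) * M := by
    refine Summable.mul_right _ (Summable.mul_right _ ?_)
    exact (summable_nat_add_iff 1).2 (summable_geometric_of_lt_one (by norm_num) (by norm_num))
  have hts : ∀ a, Summable (t a) := fun a =>
    Summable.of_norm_bounded hsum fun k => hbound k a
  let g : (ℕ → Fin 8) → Plane := fun a => ∑' k, t a k
  have hg : Continuous g := by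
    refine continuous_tsum (fun k => ?_) hsum hbound
    have : Continuous fun a : ℕ → Fin 8 => pt (a k) :=
      (continuous_of_discreteTopology (f := pt)).comp (continuous_apply k)
    exact this.const_smul ((3⁻¹ : ℝ) ^ (k + 1) * 2)
  have hstep : ∀ a : ℕ → Fin 8, g a = f (a 0) (g fun k => a (k + 1)) := by
    intro a
    have h1 : g a = t a 0 + ∑' k, t a (k + 1) := (hts a).tsum_eq_zero_add
    have h2 : (fun k => t a (k + 1)) = fun k => (3⁻¹ : ℝ) • t (fun k => a (k + 1)) k := by
      funext k
      simp only [t, smul_smul]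
      congr 1
      ring
    rw [h1, h2, tsum_const_smul'' (3⁻¹ : ℝ)]
    simp only [t, f, g, smul_add, smul_smul]
    rw [add_comm]
    norm_num
  refine ⟨Set.range g, Set.range_nonempty g, isCompact_range hg, ?_⟩
  clear_value g
  ext x
  simp only [Set.mem_iUnion, Set.mem_image, Set.mem_range]
  constructor
  · rintro ⟨a, rfl⟩
    exact ⟨a 0, _, ⟨_, rfl⟩, (hstep a).symm⟩
  · rintro ⟨i, _, ⟨a, rfl⟩, rfl⟩
    exact ⟨fun k => Nat.casesOn k i a, hstep _⟩

theorem existsUnique_isCarpet : ∃! K : Set Plane, IsCarpet K := by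
  obtain ⟨K, hK⟩ := exists_isCarpet
  exact ⟨K, hK, fun L hL => Set.Subset.antisymm (hL.subset hK) (hK.subset hL)⟩

/-- The Sierpiński carpet `K`, the unique non-empty compact set with `K = ⋃ i, f_i(K)`. -/
noncomputable def carpet : Set Plane := existsUnique_isCarpet.choose

theorem isCarpet_carpet : IsCarpet carpet := existsUnique_isCarpet.choose_spec.1

/-- The set `W_n` of words of length `n` in the letters `0, …, 7`. -/
abbrev W (n : ℕ) : Type := Fin n → Fin 8

/-- The map `f_w = f_{w_1} ∘ … ∘ f_{w_n}`. -/
noncomputable def fw : {n : ℕ} → W n → Plane → Plane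
  | 0, _ => id
  | _ + 1, w => f (w 0) ∘ fw (Fin.tail w)

/-- The cell `K_w = f_w(K)`. -/
noncomputable def cell {n : ℕ} (w : W n) : Set Plane := fw w '' carpet

open Classical in
/-- `V_0 = {p_0, …, p_7}` and `V_{n+1} = ⋃ i, f_i(V_n)`. -/
noncomputable def V : ℕ → Finset Plane
  | 0 => Finset.univ.image pt
  | n + 1 => Finset.univ.biUnion fun i : Fin 8 => (V n).image (f i)

/-- `V_w = f_w(V_0)`. -/
noncomputable def Vw {n : ℕ} (w : W n) : Set Plane := fw w '' (V 0 : Set Plane)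

theorem f_pt (i : Fin 8) : f i (pt i) = pt i := by
  simp only [f, smul_add, smul_smul, ← add_smul]
  norm_num

theorem pt_mem_V (n : ℕ) (i : Fin 8) : pt i ∈ V n := by
  classical
  induction n with
  | zero => simp [V]
  | succ n ih =>
    simp only [V, Finset.mem_biUnion, Finset.mem_univ, true_and, Finset.mem_image]
    exact ⟨i, pt i, ih, f_pt i⟩

/-- `p_i`, as a point of `V_n`. -/
noncomputable def ptV (n : ℕ) (i : Fin 8) : V n := ⟨pt i, pt_mem_V n i⟩

/-- The word `iⁿ = i…i` of length `n`. -/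
def constWord (n : ℕ) (i : Fin 8) : W n := fun _ => i

/-- The effective resistance between `A` and `B` for the energy `D` on functions on `X`:
`inf {D(u) : u = 0 on A, u = 1 on B}⁻¹`, with values in `[0, ∞]`.
(The infimum of the empty set is `∞`, so a point has resistance `0` to itself.) -/
noncomputable def effRes {X : Type} (D : (X → ℝ) → ℝ) (A B : Set X) : ℝ≥0∞ :=
  (⨅ (u : X → ℝ) (_ : (∀ x ∈ A, u x = 0) ∧ (∀ x ∈ B, u x = 1)), ENNReal.ofReal (D u))⁻¹

open Classical in
/-- The energy `D_n(u, u) = ∑_{w ∈ W_n} ∑_{p, q ∈ V_w, |p - q| = 2⁻¹ 3⁻ⁿ} (u(p) - u(q))²`.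
The inner sum runs over unordered pairs: the factor `1 / 2` undoes the double count of ordered
pairs, so that an edge contributes once for each cell `w` that contains it. -/
noncomputable def energyV (n : ℕ) (u : V n → ℝ) : ℝ :=
  ∑ w : W n, (1 / 2) * ∑ p : V n, ∑ q : V n,
    if (p : Plane) ∈ Vw w ∧ (q : Plane) ∈ Vw w ∧ dist (p : Plane) (q : Plane) = 2⁻¹ * (3⁻¹) ^ n
    then (u p - u q) ^ 2 else 0

/-- Adjacency in the cell graph: `w¹ ~ₙ w²` iff `K_{w¹} ∩ K_{w²}` has Hausdorff dimension `1`. -/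
def AdjW {n : ℕ} (w w' : W n) : Prop := dimH (cell w ∩ cell w') = 1

open Classical in
/-- The energy of the cell graph, the sum of `(u(w¹) - u(w²))²` over the (unordered) edges. -/
noncomputable def energyW (n : ℕ) (u : W n → ℝ) : ℝ :=
  (1 / 2) * ∑ w : W n, ∑ w' : W n, if AdjW w w' then (u w - u w') ^ 2 else 0

/-- `R_n(p, q)` for points `p`, `q` of `V_n`. -/
noncomputable def resV (n : ℕ) (p q : V n) : ℝ≥0∞ := effRes (energyV n) {p} {q}

/-- `R_n^V`, the resistance between the left side `V_n ∩ {0} × [0, 1]` and the right side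
`V_n ∩ {1} × [0, 1]`. -/
noncomputable def resLR (n : ℕ) : ℝ≥0∞ :=
  effRes (energyV n)
    {p | (p : Plane) 0 = 0 ∧ (p : Plane) 1 ∈ Set.Icc (0 : ℝ) 1}
    {p | (p : Plane) 0 = 1 ∧ (p : Plane) 1 ∈ Set.Icc (0 : ℝ) 1}

/-- The resistance between two words of length `n` in the cell graph. -/
noncomputable def resW (n : ℕ) (w w' : W n) : ℝ≥0∞ := effRes (energyW n) {w} {w'}

end SC

/-! Everything is governed by one sequence: `conductance n`, here `c_n`, the least energy at level
`n` of a function equal to 0 on the left side and 1 on the right side, so that `c_n` is the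
reciprocal of `R_n^V`. The core is that `c_{m+n}` and `c_m c_n` are comparable with constants
independent of `m` and `n`. Fekete's lemma, applied to `log c_n` from both sides, then yields `ρ`
with `c_n ρ^n` bounded above and below (`exists_growth_rate`). Its range comes from `(2/3) c_m ≤
c_{m+1} ≤ (6/7) c_m`, which compares the first subdivision with series and parallel circuits.

Upper bound (`conductance_add_le`): a function on the coarse grid is extended into each cell by
bilinear interpolation of its corner values, with the coordinates `x, y` replaced by `h(x,y)` and
`h(y,x)`, where `h` is the level-`m` potential. The symmetry of `h` makes neighbouring pieces agree
on the common side.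

Lower bound (`conductance_mul_le`): the level-`(m+n)` potential is replaced, on each `n`-cell, by
its mean over the left side of the cell, weighted by the flux of `h`. By Cauchy-Schwarz the means
over opposite sides differ in square by at most `E / c_m`, where `E` is the energy in the cell;
folding along the diagonal gives the same for adjacent sides, up to a factor 2. So the means form a
function on cells of energy at most a constant times `c_{m+n} / c_m`, and this is transferred to
`V_n`.

For point-to-point resistances the same means give `r_{m+n} ≤ 6 r_m + C_n / c_m`. With `n = N` fixed
so that `ρ^N > 12`, the factor 6 is absorbed and the bound `C ρ^n` follows by induction. For the
lower bounds, interpolation produces a function that is 0 at `p_0`, 1 on the whole square of `f_1`,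
and of energy at most a constant times `c_m`. The cell graph is compared with the point graph by
sampling in both directions, and the symmetries of the square give the equalities. -/

namespace SC

/-! ### Coordinates in the unit square -/

/-- Twice the first coordinate of `p_i`. -/
def dx : Fin 8 → ℤ := ![0, 1, 2, 2, 2, 1, 0, 0]

/-- Twice the second coordinate of `p_i`. -/
def dy : Fin 8 → ℤ := ![0, 0, 0, 1, 2, 2, 2, 1]

@[simp] theorem dx_apply : dx 0 = 0 ∧ dx 1 = 1 ∧ dx 2 = 2 ∧ dx 3 = 2 ∧ dx 4 = 2 ∧ dx 5 = 1 ∧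
    dx 6 = 0 ∧ dx 7 = 0 := by decide

@[simp] theorem dy_apply : dy 0 = 0 ∧ dy 1 = 0 ∧ dy 2 = 0 ∧ dy 3 = 1 ∧ dy 4 = 2 ∧ dy 5 = 2 ∧
    dy 6 = 2 ∧ dy 7 = 1 := by decide

theorem pt_zero (i : Fin 8) : pt i 0 = dx i / 2 := by
  fin_cases i <;> simp [pt, dx]

theorem pt_one (i : Fin 8) : pt i 1 = dy i / 2 := by
  fin_cases i <;> simp [pt, dy]

theorem f_zero (i : Fin 8) (x : Plane) : f i x 0 = (x 0 + dx i) / 3 := by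
  simp [f, pt_zero]; ring

theorem f_one (i : Fin 8) (x : Plane) : f i x 1 = (x 1 + dy i) / 3 := by
  simp [f, pt_one]; ring

theorem plane_ext {p q : Plane} (h0 : p 0 = q 0) (h1 : p 1 = q 1) : p = q := by
  ext i; fin_cases i <;> assumption

theorem dx_mem (i : Fin 8) : 0 ≤ dx i ∧ dx i ≤ 2 := by revert i; decide

theorem dy_mem (i : Fin 8) : 0 ≤ dy i ∧ dy i ≤ 2 := by revert i; decide

/-- The unit square. -/
def sq : Set Plane := {p | p 0 ∈ Set.Icc (0 : ℝ) 1 ∧ p 1 ∈ Set.Icc (0 : ℝ) 1}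

theorem dx_mem_real (i : Fin 8) : (0 : ℝ) ≤ dx i ∧ (dx i : ℝ) ≤ 2 := by
  exact_mod_cast dx_mem i

theorem dy_mem_real (i : Fin 8) : (0 : ℝ) ≤ dy i ∧ (dy i : ℝ) ≤ 2 := by
  exact_mod_cast dy_mem i

theorem pt_mem_sq (i : Fin 8) : pt i ∈ sq := by
  have h := dx_mem_real i
  have h' := dy_mem_real i
  simp only [sq, Set.mem_ofPred_eq, Set.mem_Icc, pt_zero, pt_one]
  refine ⟨⟨?_, ?_⟩, ?_, ?_⟩ <;> linarith

theorem f_mem_sq (i : Fin 8) {p : Plane} (hp : p ∈ sq) : f i p ∈ sq := by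
  have h := dx_mem_real i
  have h' := dy_mem_real i
  obtain ⟨⟨h1, h2⟩, h3, h4⟩ := hp
  simp only [sq, Set.mem_ofPred_eq, Set.mem_Icc, f_zero, f_one]
  refine ⟨⟨?_, ?_⟩, ?_, ?_⟩ <;> linarith

theorem fw_mem_sq {n : ℕ} (w : W n) {p : Plane} (hp : p ∈ sq) : fw w p ∈ sq := by
  induction n with
  | zero => exact hp
  | succ n ih => exact f_mem_sq _ (ih _)

theorem fw_cons {n : ℕ} (i : Fin 8) (w : W n) (p : Plane) :
    fw (Fin.cons i w : W (n + 1)) p = f i (fw w p) := by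
  simp [fw]

/-! ### The energy form and its self-similarity -/

/-- The difference of `u` along the edge `x.2` of the boundary of the cell `x.1`. -/
noncomputable def grad (n : ℕ) (u : Plane → ℝ) (x : W n × Fin 8) : ℝ :=
  u (fw x.1 (pt x.2)) - u (fw x.1 (pt (x.2 + 1)))

/-- The energy form, on functions on the plane. -/
noncomputable def eform (n : ℕ) (u v : Plane → ℝ) : ℝ := ∑ x, grad n u x * grad n v x

/-- The energy of a function on the plane. -/
noncomputable def energy (n : ℕ) (u : Plane → ℝ) : ℝ := ∑ x, grad n u x ^ 2

theorem eform_self (n : ℕ) (u : Plane → ℝ) : eform n u u = energy n u := by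
  simp [eform, energy, pow_two]

theorem eform_comm (n : ℕ) (u v : Plane → ℝ) : eform n u v = eform n v u := by
  simp [eform, mul_comm]

theorem grad_congr {n : ℕ} {u v : Plane → ℝ} (h : ∀ p ∈ sq, u p = v p) :
    grad n u = grad n v := by
  funext x
  simp only [grad]
  rw [h _ (fw_mem_sq _ (pt_mem_sq _)), h _ (fw_mem_sq _ (pt_mem_sq _))]

theorem eform_congr {n : ℕ} {u u' v v' : Plane → ℝ} (h : ∀ p ∈ sq, u p = u' p)
    (h' : ∀ p ∈ sq, v p = v' p) : eform n u v = eform n u' v' := by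
  simp only [eform, grad_congr h, grad_congr h']

theorem energy_congr {n : ℕ} {u v : Plane → ℝ} (h : ∀ p ∈ sq, u p = v p) :
    energy n u = energy n v := by
  simp only [energy, grad_congr h]

theorem energy_nonneg (n : ℕ) (u : Plane → ℝ) : 0 ≤ energy n u :=
  Finset.sum_nonneg fun _ _ => sq_nonneg _

theorem eform_sq_le (n : ℕ) (u v : Plane → ℝ) :
    eform n u v ^ 2 ≤ energy n u * energy n v :=
  Finset.sum_mul_sq_le_sq_mul_sq _ _ _

theorem eform_add_right (n : ℕ) (u v v' : Plane → ℝ) :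
    eform n u (fun p => v p + v' p) = eform n u v + eform n u v' := by
  simp only [eform, ← Finset.sum_add_distrib]
  exact Finset.sum_congr rfl fun x _ => by simp only [grad]; ring

theorem eform_sub_right (n : ℕ) (u v v' : Plane → ℝ) :
    eform n u (fun p => v p - v' p) = eform n u v - eform n u v' := by
  simp only [eform, ← Finset.sum_sub_distrib]
  exact Finset.sum_congr rfl fun x _ => by simp only [grad]; ring

theorem eform_const_right (n : ℕ) (u : Plane → ℝ) (c : ℝ) :
    eform n u (fun _ => c) = 0 := by
  simp [eform, grad]

theorem energy_add_mul (n : ℕ) (u v : Plane → ℝ) (t : ℝ) :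
    energy n (fun p => u p + t * v p) =
      energy n u + 2 * t * eform n u v + t ^ 2 * energy n v := by
  simp only [energy, eform, Finset.mul_sum, ← Finset.sum_add_distrib]
  exact Finset.sum_congr rfl fun x _ => by simp only [grad]; ring

theorem energy_affine (n : ℕ) (u : Plane → ℝ) (a b : ℝ) :
    energy n (fun p => a + b * u p) = b ^ 2 * energy n u := by
  simp only [energy, Finset.mul_sum]
  exact Finset.sum_congr rfl fun x _ => by simp only [grad]; ring

theorem energy_midpoint_le (n : ℕ) (u v : Plane → ℝ) :
    energy n (fun p => (u p + v p) / 2) ≤ (energy n u + energy n v) / 2 := by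
  simp only [energy, ← Finset.sum_add_distrib, Finset.sum_div]
  refine Finset.sum_le_sum fun x _ => ?_
  simp only [grad]
  set a := u (fw x.1 (pt x.2))
  set b := u (fw x.1 (pt (x.2 + 1)))
  set c := v (fw x.1 (pt x.2))
  set d := v (fw x.1 (pt (x.2 + 1)))
  nlinarith [sq_nonneg ((a - b) - (c - d))]

theorem energy_succ (n : ℕ) (u : Plane → ℝ) :
    energy (n + 1) u = ∑ i : Fin 8, energy n (u ∘ f i) := by
  simp only [energy, Fintype.sum_prod_type]
  rw [← (Fin.consEquiv fun _ : Fin (n + 1) => Fin 8).sum_comp, Fintype.sum_prod_type]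
  simp [grad, Fin.consEquiv, fw_cons]

theorem eform_succ (n : ℕ) (u v : Plane → ℝ) :
    eform (n + 1) u v = ∑ i : Fin 8, eform n (u ∘ f i) (v ∘ f i) := by
  simp only [eform, Fintype.sum_prod_type]
  rw [← (Fin.consEquiv fun _ : Fin (n + 1) => Fin 8).sum_comp, Fintype.sum_prod_type]
  simp [grad, Fin.consEquiv, fw_cons]

theorem energy_add (m n : ℕ) (u : Plane → ℝ) :
    energy (m + n) u = ∑ w : W n, energy m (u ∘ fw w) := by
  induction n generalizing u with
  | zero => simp [fw]
  | succ n ih =>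
    rw [← add_assoc, energy_succ, ← (Fin.consEquiv fun _ : Fin (n + 1) => Fin 8).sum_comp,
      Fintype.sum_prod_type]
    refine Finset.sum_congr rfl fun i _ => ?_
    rw [ih]
    rfl

theorem energy_eq_sum (n : ℕ) (u : Plane → ℝ) :
    energy n u = ∑ w : W n, energy 0 (u ∘ fw w) := by
  rw [← energy_add, zero_add]

theorem energy_zero (u : Plane → ℝ) :
    energy 0 u = ∑ i : Fin 8, (u (pt i) - u (pt (i + 1))) ^ 2 := by
  simp [energy, Fintype.sum_prod_type, grad, fw]

theorem eform_zero (u v : Plane → ℝ) :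
    eform 0 u v = ∑ i : Fin 8, (u (pt i) - u (pt (i + 1))) * (v (pt i) - v (pt (i + 1))) := by
  simp [eform, Fintype.sum_prod_type, grad, fw]

theorem energy_comp_fw_le (m : ℕ) {n : ℕ} (u : Plane → ℝ) (w : W n) :
    energy m (u ∘ fw w) ≤ energy (m + n) u := by
  rw [energy_add]
  exact Finset.single_le_sum (f := fun w : W n => energy m (u ∘ fw w))
    (fun _ _ => energy_nonneg _ _) (Finset.mem_univ w)

/-! ### Symmetries of the energy and folding along the diagonal -/

/-- The reflection `(x, y) ↦ (1 - x, y)`. -/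
noncomputable def reflX (p : Plane) : Plane := !₂[1 - p 0, p 1]

/-- The reflection `(x, y) ↦ (y, x)`. -/
noncomputable def swap (p : Plane) : Plane := !₂[p 1, p 0]

@[simp] theorem reflX_zero (p : Plane) : reflX p 0 = 1 - p 0 := rfl
@[simp] theorem reflX_one (p : Plane) : reflX p 1 = p 1 := rfl
@[simp] theorem swap_zero (p : Plane) : swap p 0 = p 1 := rfl
@[simp] theorem swap_one (p : Plane) : swap p 1 = p 0 := rfl

theorem reflX_reflX (p : Plane) : reflX (reflX p) = p := plane_ext (by simp) (by simp)

theorem reflX_pt (i : Fin 8) : reflX (pt i) = pt (2 - i) := by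
  refine plane_ext ?_ ?_ <;> fin_cases i <;> simp [pt] <;> norm_num

theorem swap_pt (i : Fin 8) : swap (pt i) = pt (-i) := by
  refine plane_ext ?_ ?_ <;> fin_cases i <;> simp [pt]

theorem f_reflX (i : Fin 8) (p : Plane) : f (2 - i) (reflX p) = reflX (f i p) := by
  rw [f, ← reflX_pt]
  refine plane_ext ?_ ?_ <;> simp [f]
  ring

theorem f_swap (i : Fin 8) (p : Plane) : f (-i) (swap p) = swap (f i p) := by
  rw [f, ← swap_pt]
  refine plane_ext ?_ ?_ <;> simp [f]

theorem eform_comp_reflX (n : ℕ) (u v : Plane → ℝ) :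
    eform n (u ∘ reflX) (v ∘ reflX) = eform n u v := by
  induction n generalizing u v with
  | zero =>
    simp only [eform_zero, Function.comp, reflX_pt]
    -- The reflection sends `p_i` to `p_{2-i}`, hence the edge from `p_i` to `p_{i+1}` to the edge
    -- with index `1 - i`, reversed.
    rw [← (Equiv.subLeft (1 : Fin 8)).sum_comp]
    refine Finset.sum_congr rfl fun i _ => ?_
    have h1 : (2 : Fin 8) - (1 - i) = i + 1 := by revert i; decide
    have h2 : (2 : Fin 8) - (1 - i + 1) = i := by revert i; decide
    simp only [Equiv.subLeft_apply, h1, h2]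
    ring
  | succ n ih =>
    rw [eform_succ, eform_succ, ← (Equiv.subLeft (2 : Fin 8)).sum_comp]
    refine Finset.sum_congr rfl fun i _ => ?_
    rw [← ih (u ∘ f i)]
    have h (u : Plane → ℝ) : (u ∘ reflX) ∘ f (2 - i) = (u ∘ f i) ∘ reflX := by
      funext p
      simp only [Function.comp]
      rw [← f_reflX, sub_sub_cancel]
    simp only [Equiv.subLeft_apply, h]

theorem eform_comp_swap (n : ℕ) (u v : Plane → ℝ) :
    eform n (u ∘ swap) (v ∘ swap) = eform n u v := by
  induction n generalizing u v with
  | zero =>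
    simp only [eform_zero, Function.comp, swap_pt]
    rw [← (Equiv.subLeft (-1 : Fin 8)).sum_comp]
    refine Finset.sum_congr rfl fun i _ => ?_
    have h1 : -((-1 : Fin 8) - i) = i + 1 := by revert i; decide
    have h2 : -((-1 : Fin 8) - i + 1) = i := by revert i; decide
    simp only [Equiv.subLeft_apply, h1, h2]
    ring
  | succ n ih =>
    rw [eform_succ, eform_succ]
    refine (Equiv.sum_comp (Equiv.neg (Fin 8)) _).symm.trans ?_
    refine Finset.sum_congr rfl fun i _ => ?_
    rw [← ih (u ∘ f i)]
    have h (u : Plane → ℝ) : (u ∘ swap) ∘ f (-i) = (u ∘ f i) ∘ swap := by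
      funext p
      simp only [Function.comp]
      rw [← f_swap, neg_neg]
    simp only [Equiv.neg_apply, h]

theorem energy_comp_reflX (n : ℕ) (u : Plane → ℝ) : energy n (u ∘ reflX) = energy n u := by
  rw [← eform_self, eform_comp_reflX, eform_self]

theorem energy_comp_swap (n : ℕ) (u : Plane → ℝ) : energy n (u ∘ swap) = energy n u := by
  rw [← eform_self, eform_comp_swap, eform_self]

/-- The reflection `(x, y) ↦ (x, 1 - y)`. -/
noncomputable def reflY (p : Plane) : Plane := !₂[p 0, 1 - p 1]

@[simp] theorem reflY_zero (p : Plane) : reflY p 0 = p 0 := rfl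
@[simp] theorem reflY_one (p : Plane) : reflY p 1 = 1 - p 1 := rfl
theorem reflY_reflY (p : Plane) : reflY (reflY p) = p := plane_ext (by simp) (by simp)

theorem reflY_eq : reflY = swap ∘ reflX ∘ swap := by
  funext p; exact plane_ext (by simp) (by simp)

theorem eform_comp_reflY (n : ℕ) (u v : Plane → ℝ) :
    eform n (u ∘ reflY) (v ∘ reflY) = eform n u v := by
  have h (u : Plane → ℝ) : u ∘ reflY = ((u ∘ swap) ∘ reflX) ∘ swap := by
    rw [reflY_eq]; rfl
  rw [h, h, eform_comp_swap, eform_comp_reflX, eform_comp_swap]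

theorem energy_comp_reflY (n : ℕ) (u : Plane → ℝ) : energy n (u ∘ reflY) = energy n u := by
  rw [← eform_self, eform_comp_reflY, eform_self]

/-- The folding `(x, y) ↦ (min x y, max x y)` along the diagonal. -/
noncomputable def fold (p : Plane) : Plane := !₂[min (p 0) (p 1), max (p 0) (p 1)]

@[simp] theorem fold_zero (p : Plane) : fold p 0 = min (p 0) (p 1) := rfl
@[simp] theorem fold_one (p : Plane) : fold p 1 = max (p 0) (p 1) := rfl

theorem fold_of_le {p : Plane} (h : p 0 ≤ p 1) : fold p = p :=
  plane_ext (by simp [h]) (by simp [h])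

theorem fold_of_ge {p : Plane} (h : p 1 ≤ p 0) : fold p = swap p :=
  plane_ext (by simp [h]) (by simp [h])

/-- Composition with `fold` keeps the values above the diagonal and mirrors them below it.
Off-diagonal cells above the diagonal are thus counted twice, those below not at all, and the two
diagonal cells are folded in the same way one level down. -/
theorem energy_comp_fold_le (n : ℕ) (u : Plane → ℝ) : energy n (u ∘ fold) ≤ 2 * energy n u := by
  induction n generalizing u with
  | zero =>
    have h1 : ∀ i ∈ ({0, 4, 5, 6, 7} : Finset (Fin 8)), fold (pt i) = pt i := by
      intro i hi
      refine fold_of_le ?_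
      rw [pt_zero, pt_one]
      have : dx i ≤ dy i := by revert i; decide
      have : (dx i : ℝ) ≤ dy i := by exact_mod_cast this
      linarith
    have h2 : ∀ i ∈ ({1, 2, 3} : Finset (Fin 8)), fold (pt i) = pt (-i) := by
      intro i hi
      rw [fold_of_ge, swap_pt]
      rw [pt_zero, pt_one]
      have : dy i ≤ dx i := by revert i; decide
      have : (dy i : ℝ) ≤ dx i := by exact_mod_cast this
      linarith
    have e1 : -(1 : Fin 8) = 7 := by decide
    have e2 : -(2 : Fin 8) = 6 := by decide
    have e3 : -(3 : Fin 8) = 5 := by decide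
    simp only [energy_zero, Fin.sum_univ_eight, Function.comp, Fin.reduceAdd]
    rw [h1 0 (by decide), h1 4 (by decide), h1 5 (by decide), h1 6 (by decide), h1 7 (by decide),
      h2 1 (by decide), h2 2 (by decide), h2 3 (by decide), e1, e2, e3]
    nlinarith [sq_nonneg (u (pt 0) - u (pt 1)), sq_nonneg (u (pt 1) - u (pt 2)),
      sq_nonneg (u (pt 2) - u (pt 3)), sq_nonneg (u (pt 3) - u (pt 4))]
  | succ n ih =>
    have hd : ∀ i : Fin 8, dx i = dy i → energy n ((u ∘ fold) ∘ f i) ≤ 2 * energy n (u ∘ f i) := by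
      intro i hi
      refine le_of_eq_of_le (congrArg _ ?_) (ih _)
      funext p
      simp only [Function.comp]
      congr 1
      refine plane_ext ?_ ?_
      · simp only [fold_zero, f_zero, f_one, hi, min_div_div_right (zero_le_three (α := ℝ)),
          min_add_add_right]
      · simp only [fold_one, f_zero, f_one, hi, max_div_div_right (zero_le_three (α := ℝ)),
          max_add_add_right]
    have hu : ∀ i : Fin 8, dx i < dy i → energy n ((u ∘ fold) ∘ f i) = energy n (u ∘ f i) := by
      intro i hi
      refine energy_congr fun p hp => ?_
      obtain ⟨⟨h1, h2⟩, h3, h4⟩ := hp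
      have hi' : (dx i : ℝ) + 1 ≤ dy i := by exact_mod_cast hi
      simp only [Function.comp]
      rw [fold_of_le]
      rw [f_zero, f_one]
      linarith
    have hl : ∀ i : Fin 8, dy i < dx i → energy n ((u ∘ fold) ∘ f i) = energy n (u ∘ f (-i)) := by
      intro i hi
      rw [← energy_comp_swap n (u ∘ f (-i))]
      refine energy_congr fun p hp => ?_
      obtain ⟨⟨h1, h2⟩, h3, h4⟩ := hp
      have hi' : (dy i : ℝ) + 1 ≤ dx i := by exact_mod_cast hi
      simp only [Function.comp]
      rw [fold_of_ge, f_swap]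
      rw [f_zero, f_one]
      linarith
    have e1 : -(1 : Fin 8) = 7 := by decide
    have e2 : -(2 : Fin 8) = 6 := by decide
    have e3 : -(3 : Fin 8) = 5 := by decide
    rw [energy_succ, energy_succ, Fin.sum_univ_eight, Fin.sum_univ_eight,
      hl 1 (by decide), hl 2 (by decide), hl 3 (by decide), hu 5 (by decide), hu 6 (by decide),
      hu 7 (by decide), e1, e2, e3]
    have := hd 0 (by decide)
    have := hd 4 (by decide)
    have := energy_nonneg n (u ∘ f 1)
    have := energy_nonneg n (u ∘ f 2)
    have := energy_nonneg n (u ∘ f 3)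
    linarith

/-! ### The left-to-right potential and the conductance -/

/-- The functions that vanish on the line `x = 0` and are equal to `1` on the line `x = 1`. -/
def admissible : Set (Plane → ℝ) :=
  {u | (∀ p : Plane, p 0 = 0 → u p = 0) ∧ ∀ p : Plane, p 0 = 1 → u p = 1}

theorem continuous_energy (n : ℕ) : Continuous (energy n) := by
  unfold energy grad
  fun_prop

theorem energy_clamp_le (n : ℕ) (u : Plane → ℝ) :
    energy n (fun p => max 0 (min 1 (u p))) ≤ energy n u := by
  refine Finset.sum_le_sum fun x _ => sq_le_sq.2 ?_
  refine (abs_max_sub_max_le_max _ _ _ _).trans (max_le (by simp) ?_)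
  exact (abs_min_sub_min_le_max _ _ _ _).trans (max_le (by simp) le_rfl)

/-- The energy is continuous for the product topology and truncation to `[0, 1]` does not increase
it, so a minimiser exists by Tychonoff. Averaging it with `1 - h ∘ reflX`, and the result with its
image under `reflY`, keeps it minimal by convexity and makes it symmetric. -/
theorem exists_potential (n : ℕ) : ∃ h : Plane → ℝ, h ∈ admissible ∧
    (∀ p, h p ∈ Set.Icc (0 : ℝ) 1) ∧ (∀ p, h (reflX p) = 1 - h p) ∧
    (∀ p, h (reflY p) = h p) ∧ ∀ u ∈ admissible, energy n h ≤ energy n u := by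
  let s : Plane → Set ℝ := fun p =>
    if p 0 = 0 then {0} else if p 0 = 1 then {1} else Set.Icc 0 1
  have hs : ∀ p, IsCompact (s p) := by
    intro p
    simp only [s]
    split_ifs
    · exact isCompact_singleton
    · exact isCompact_singleton
    · exact isCompact_Icc
  have hmem : ∀ u : Plane → ℝ, u ∈ admissible → (∀ p, u p ∈ Set.Icc (0 : ℝ) 1) →
      u ∈ Set.pi Set.univ s := by
    intro u hu hu' p _
    simp only [s]
    split_ifs with h0 h1
    · exact hu.1 p h0
    · exact hu.2 p h1
    · exact hu' p
  have hne : (Set.pi Set.univ s).Nonempty := by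
    refine ⟨fun p => if p 0 = 1 then 1 else 0, hmem _ ⟨?_, ?_⟩ ?_⟩
    · intro p hp
      simp [hp]
    · intro p hp
      simp [hp]
    · intro p
      dsimp only
      split_ifs <;> simp
  obtain ⟨h, hh, hmin⟩ := (isCompact_univ_pi hs).exists_isMinOn hne
    (continuous_energy n).continuousOn
  have hmin' : ∀ u ∈ admissible, energy n h ≤ energy n u := by
    intro u hu
    refine le_trans (hmin (hmem (fun p => max 0 (min 1 (u p))) ⟨?_, ?_⟩ ?_)) (energy_clamp_le n u)
    · intro p hp
      simp [hu.1 p hp]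
    · intro p hp
      simp [hu.2 p hp]
    · intro p
      simp
  have h0 : ∀ p : Plane, p 0 = 0 → h p = 0 := fun p hp => by
    have := hh p trivial
    simpa [s, hp] using this
  have h1 : ∀ p : Plane, p 0 = 1 → h p = 1 := fun p hp => by
    have := hh p trivial
    simpa [s, hp] using this
  have hI : ∀ p, h p ∈ Set.Icc (0 : ℝ) 1 := fun p => by
    have := hh p trivial
    simp only [s] at this
    split_ifs at this with a b
    · rw [h0 p a]; simp
    · rw [h1 p b]; simp
    · exact this
  clear_value s
  let k : Plane → ℝ := fun p => (h p + (1 + -1 * (h ∘ reflX) p)) / 2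
  have hk : energy n k ≤ energy n h := by
    have := energy_midpoint_le n h fun p => 1 + -1 * (h ∘ reflX) p
    rw [energy_affine, energy_comp_reflX] at this
    linarith
  let g : Plane → ℝ := fun p => (k p + (k ∘ reflY) p) / 2
  have hg : energy n g ≤ energy n h := by
    have := energy_midpoint_le n k (k ∘ reflY)
    rw [energy_comp_reflY] at this
    linarith
  have hc : ∀ p, reflX (reflY p) = reflY (reflX p) := fun p => plane_ext (by simp) (by simp)
  refine ⟨g, ⟨?_, ?_⟩, ?_, ?_, ?_, fun u hu => hg.trans (hmin' u hu)⟩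
  · intro p hp
    simp [g, k, h0 p hp, h0 (reflY p) (by simpa using hp), h1 (reflX p) (by simp [hp]),
      h1 (reflX (reflY p)) (by simp [hp])]
  · intro p hp
    simp [g, k, h1 p hp, h1 (reflY p) (by simpa using hp), h0 (reflX p) (by simp [hp]),
      h0 (reflX (reflY p)) (by simp [hp])]
  · intro p
    have h1 := hI p
    have h2 := hI (reflX p)
    have h3 := hI (reflY p)
    have h4 := hI (reflX (reflY p))
    simp only [Set.mem_Icc] at h1 h2 h3 h4
    simp only [g, k, Function.comp, Set.mem_Icc]
    constructor <;> linarith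
  · intro p
    simp only [g, k, Function.comp, reflX_reflX]
    rw [← hc p, reflX_reflX]
    ring
  · intro p
    simp only [g, k, Function.comp, reflY_reflY]
    ring

/-- The symmetric potential between the left and the right side. -/
noncomputable def potential (n : ℕ) : Plane → ℝ := (exists_potential n).choose

/-- The conductance between the left and the right side. -/
noncomputable def conductance (n : ℕ) : ℝ := energy n (potential n)

theorem potential_admissible (n : ℕ) : potential n ∈ admissible :=
  (exists_potential n).choose_spec.1

theorem potential_mem_Icc (n : ℕ) (p : Plane) : potential n p ∈ Set.Icc (0 : ℝ) 1 :=
  (exists_potential n).choose_spec.2.1 p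

theorem potential_reflX (n : ℕ) (p : Plane) : potential n (reflX p) = 1 - potential n p :=
  (exists_potential n).choose_spec.2.2.1 p

theorem potential_reflY (n : ℕ) (p : Plane) : potential n (reflY p) = potential n p :=
  (exists_potential n).choose_spec.2.2.2.1 p

theorem conductance_le (n : ℕ) {u : Plane → ℝ} (hu : u ∈ admissible) :
    conductance n ≤ energy n u :=
  (exists_potential n).choose_spec.2.2.2.2 u hu

theorem f_one_pt_corners : f 0 (pt 2) = f 1 (pt 0) ∧ f 1 (pt 2) = f 2 (pt 0) := by
  constructor <;> refine plane_ext ?_ ?_ <;>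
    simp [f_zero, f_one, pt_zero, pt_one]
  norm_num

/-- Cauchy-Schwarz along the bottom side, a path of `2 * 3 ^ n` edges. The crude constant suffices,
since the bound only serves to show that the conductance is positive. -/
theorem sq_sub_corners_le (n : ℕ) (u : Plane → ℝ) :
    (u (pt 0) - u (pt 2)) ^ 2 ≤ 2 * 3 ^ n * energy n u := by
  induction n generalizing u with
  | zero =>
    have h : (u (pt 0) - u (pt 1)) ^ 2 + (u (pt 1) - u (pt 2)) ^ 2 ≤ energy 0 u := by
      rw [energy_zero, Fin.sum_univ_eight]
      simp only [Fin.reduceAdd]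
      have := sq_nonneg (u (pt 2) - u (pt 3))
      have := sq_nonneg (u (pt 3) - u (pt 4))
      have := sq_nonneg (u (pt 4) - u (pt 5))
      have := sq_nonneg (u (pt 5) - u (pt 6))
      have := sq_nonneg (u (pt 6) - u (pt 7))
      have := sq_nonneg (u (pt 7) - u (pt 0))
      linarith
    nlinarith [sq_nonneg ((u (pt 0) - u (pt 1)) - (u (pt 1) - u (pt 2)))]
  | succ n ih =>
    have h0 := ih (u ∘ f 0)
    have h1 := ih (u ∘ f 1)
    have h2 := ih (u ∘ f 2)
    simp only [Function.comp, f_pt, f_one_pt_corners.1, f_one_pt_corners.2] at h0 h1 h2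
    have h : energy n (u ∘ f 0) + energy n (u ∘ f 1) + energy n (u ∘ f 2) ≤ energy (n + 1) u := by
      rw [energy_succ, Fin.sum_univ_eight]
      have := energy_nonneg n (u ∘ f 3)
      have := energy_nonneg n (u ∘ f 4)
      have := energy_nonneg n (u ∘ f 5)
      have := energy_nonneg n (u ∘ f 6)
      have := energy_nonneg n (u ∘ f 7)
      linarith
    have h' := mul_le_mul_of_nonneg_left h (show (0 : ℝ) ≤ 2 * 3 ^ (n + 1) by positivity)
    refine le_trans ?_ h'
    set a := u (pt 0) - u (f 1 (pt 0))
    set b := u (f 1 (pt 0)) - u (f 2 (pt 0))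
    set c := u (f 2 (pt 0)) - u (pt 2)
    have e : u (pt 0) - u (pt 2) = a + b + c := by simp only [a, b, c]; ring
    rw [e, pow_succ (3 : ℝ) n]
    nlinarith [sq_nonneg (a - b), sq_nonneg (b - c), sq_nonneg (a - c)]

theorem conductance_pos (n : ℕ) : 0 < conductance n := by
  have h := sq_sub_corners_le n (potential n)
  rw [(potential_admissible n).1 (pt 0) (by simp [pt_zero]),
    (potential_admissible n).2 (pt 2) (by simp [pt_zero])] at h
  by_contra hc
  have h2 : (2 * 3 ^ n : ℝ) * energy n (potential n) ≤ 0 :=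
    mul_nonpos_of_nonneg_of_nonpos (by positivity) (not_lt.1 hc)
  linarith

/-- First variation: adding `t * v` keeps the potential admissible, so the linear term in `t` must
vanish. -/
theorem eform_potential_eq_zero (n : ℕ) {v : Plane → ℝ} (h0 : ∀ p : Plane, p 0 = 0 → v p = 0)
    (h1 : ∀ p : Plane, p 0 = 1 → v p = 0) : eform n (potential n) v = 0 := by
  have key : ∀ t : ℝ, 0 ≤ 2 * t * eform n (potential n) v + t ^ 2 * energy n v := by
    intro t
    have h := conductance_le n (u := fun p => potential n p + t * v p)
      ⟨fun p hp => by simp [h0 p hp, (potential_admissible n).1 p hp],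
        fun p hp => by simp [h1 p hp, (potential_admissible n).2 p hp]⟩
    rw [energy_add_mul, conductance] at h
    linarith
  set b := eform n (potential n) v
  have hc := energy_nonneg n v
  set c := energy n v
  -- The minimiser would be `-b / c`; the added 1 covers the case `c = 0`.
  have h := key (-b / (c + 1))
  have h2 : 2 * (-b / (c + 1)) * b + (-b / (c + 1)) ^ 2 * c = -(b ^ 2 * (c + 2)) / (c + 1) ^ 2 := by
    field_simp
    ring
  rw [h2] at h
  by_contra hb
  have : 0 < b ^ 2 := by positivity
  have : -(b ^ 2 * (c + 2)) / (c + 1) ^ 2 < 0 := by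
    apply div_neg_of_neg_of_pos
    · nlinarith
    · positivity
  linarith

theorem eform_potential_congr (n : ℕ) {v v' : Plane → ℝ} (h0 : ∀ p : Plane, p 0 = 0 → v p = v' p)
    (h1 : ∀ p : Plane, p 0 = 1 → v p = v' p) :
    eform n (potential n) v = eform n (potential n) v' := by
  rw [← sub_eq_zero, ← eform_sub_right]
  exact eform_potential_eq_zero n (fun p hp => by simp [h0 p hp]) fun p hp => by simp [h1 p hp]

/-! ### Flux averages over a side -/

open Classical in
/-- The average of `u` over the left side, with respect to the flux of the potential. -/
noncomputable def average (n : ℕ) (u : Plane → ℝ) : ℝ :=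
  -(conductance n)⁻¹ * eform n (potential n) fun p => if p 0 = 0 then u p else 0

theorem average_congr (n : ℕ) {u v : Plane → ℝ} (h : ∀ p ∈ sq, p 0 = 0 → u p = v p) :
    average n u = average n v := by
  simp only [average]
  congr 1
  refine eform_congr (fun _ _ => rfl) fun p hp => ?_
  split_ifs with h0
  · exact h p hp h0
  · rfl

theorem average_reflY (n : ℕ) (u : Plane → ℝ) : average n (u ∘ reflY) = average n u := by
  simp only [average]
  rw [← eform_comp_reflY n (potential n)]
  congr 2
  · funext p
    simp [potential_reflY]
  · funext p
    simp [reflY_reflY]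

theorem average_one (n : ℕ) : average n (fun _ => 1) = 1 := by
  have hc := conductance_pos n
  -- By harmonicity only the values on the two sides matter, and the indicator of the left side has
  -- the same ones as `1 - h`.
  have h1 : eform n (potential n) (fun p => if p 0 = 0 then (1 : ℝ) else 0) =
      eform n (potential n) fun p => 1 - potential n p := by
    refine eform_potential_congr n (fun p hp => ?_) fun p hp => ?_
    · simp [hp, (potential_admissible n).1 p hp]
    · simp [hp, (potential_admissible n).2 p hp]
  simp only [average]
  rw [h1, eform_sub_right, eform_const_right, eform_self, ← conductance]
  field_simp
  ring

theorem average_sub (n : ℕ) (u v : Plane → ℝ) :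
    average n (fun p => u p - v p) = average n u - average n v := by
  simp only [average]
  rw [← mul_sub, ← eform_sub_right]
  congr 2
  funext p
  split_ifs <;> simp

theorem average_smul (n : ℕ) (c : ℝ) (u : Plane → ℝ) :
    average n (fun p => c * u p) = c * average n u := by
  simp only [average, eform, Finset.mul_sum]
  refine Finset.sum_congr rfl fun x _ => ?_
  simp only [grad]
  split_ifs <;> ring

theorem average_const (n : ℕ) (c : ℝ) : average n (fun _ => c) = c := by
  have := average_smul n c fun _ => 1
  rw [average_one] at this
  simpa using this

/-- The potential is 0 on the left side and nonnegative elsewhere, so the flux through every edge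
leaving that side has the same sign. With `average_one` this makes `average` a probability average.
-/
theorem average_nonneg (n : ℕ) {u : Plane → ℝ}
    (h : ∀ w : W n, ∀ i, 0 ≤ u (fw w (pt i))) : 0 ≤ average n u := by
  have hc := conductance_pos n
  rw [average, neg_mul, ← mul_neg]
  refine mul_nonneg (inv_nonneg.2 hc.le) ?_
  rw [neg_nonneg]
  refine Finset.sum_nonpos fun x _ => ?_
  have ha := h x.1 x.2
  have hb := h x.1 (x.2 + 1)
  simp only [grad]
  set p := fw x.1 (pt x.2)
  set q := fw x.1 (pt (x.2 + 1))
  have hp := (potential_mem_Icc n p).1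
  have hq := (potential_mem_Icc n q).1
  have hp0 := (potential_admissible n).1 p
  have hq0 := (potential_admissible n).1 q
  split_ifs with h1 h2 h2
  · simp [hp0 h1, hq0 h2]
  · rw [hp0 h1]
    nlinarith
  · rw [hq0 h2]
    nlinarith
  · simp

theorem average_mono (n : ℕ) {u v : Plane → ℝ}
    (h : ∀ w : W n, ∀ i, u (fw w (pt i)) ≤ v (fw w (pt i))) : average n u ≤ average n v := by
  rw [← sub_nonneg, ← average_sub]
  exact average_nonneg n fun w i => sub_nonneg.2 (h w i)

theorem sq_sub_average_le (n : ℕ) {u : Plane → ℝ} {a r : ℝ} (hr : 0 ≤ r)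
    (h : ∀ w : W n, ∀ i, (a - u (fw w (pt i))) ^ 2 ≤ r) : (a - average n u) ^ 2 ≤ r := by
  have h' : ∀ w : W n, ∀ i, |a - u (fw w (pt i))| ≤ √r := fun w i => Real.abs_le_sqrt (h w i)
  have h1 : average n u ≤ a + √r := by
    rw [← average_const n (a + √r)]
    exact average_mono n fun w i => by linarith [neg_le_of_abs_le (h' w i)]
  have h2 : a - √r ≤ average n u := by
    rw [← average_const n (a - √r)]
    exact average_mono n fun w i => by linarith [le_of_abs_le (h' w i)]
  rw [← Real.sq_sqrt hr]
  exact sq_le_sq' (by linarith) (by linarith)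

/-- Since `h ∘ reflX = 1 - h`, the average over the right side is the form of `h` against `u`
restricted to that side. The difference of the two averages is therefore `E(h, u) / c`, by
harmonicity, and Cauchy-Schwarz with `E(h, h) = c` finishes. -/
theorem sq_average_reflX_sub_le (n : ℕ) (u : Plane → ℝ) :
    (average n (u ∘ reflX) - average n u) ^ 2 ≤ (conductance n)⁻¹ * energy n u := by
  have hc := conductance_pos n
  have h1 : average n (u ∘ reflX) =
      (conductance n)⁻¹ * eform n (potential n) fun p => if p 0 = 1 then u p else 0 := by
    simp only [average]
    rw [← eform_comp_reflX n _ fun p => if p 0 = 1 then u p else 0]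
    have e : potential n ∘ reflX = fun p => 1 - potential n p := by
      funext p
      simp [potential_reflX]
    rw [e, eform_comm n fun p => 1 - potential n p, eform_sub_right, eform_const_right,
      eform_comm n _ (potential n)]
    simp [Function.comp_def]
  have h2 : average n (u ∘ reflX) - average n u =
      (conductance n)⁻¹ * eform n (potential n) u := by
    rw [h1, average, neg_mul, sub_neg_eq_add, ← mul_add, ← eform_add_right]
    congr 1
    refine eform_potential_congr n (fun p hp => ?_) fun p hp => ?_ <;> simp [hp]
  rw [h2, mul_pow]
  calc (conductance n)⁻¹ ^ 2 * eform n (potential n) u ^ 2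
      ≤ (conductance n)⁻¹ ^ 2 * (conductance n * energy n u) :=
        mul_le_mul_of_nonneg_left (eform_sq_le n _ u) (by positivity)
    _ = (conductance n)⁻¹ * energy n u := by field_simp

/-- After folding along the diagonal, the right side carries the values of `u` on the top side, so
the left-right estimate applies at the cost of the factor 2. -/
theorem sq_average_top_sub_le (n : ℕ) (u : Plane → ℝ) :
    (average n (u ∘ reflY ∘ swap) - average n u) ^ 2 ≤ (conductance n)⁻¹ * (2 * energy n u) := by
  have h := sq_average_reflX_sub_le n (u ∘ fold)
  have h1 : average n (u ∘ fold) = average n u :=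
    average_congr n fun p hp h0 => by
      simp only [Function.comp]
      rw [fold_of_le (by rw [h0]; exact hp.2.1)]
  have h2 : average n ((u ∘ fold) ∘ reflX) = average n (u ∘ reflY ∘ swap) := by
    refine average_congr n fun p hp h0 => ?_
    simp only [Function.comp]
    rw [fold_of_ge (by simpa [h0] using hp.2.2)]
    exact congrArg u (plane_ext (by simp) (by simp))
  rw [h1, h2] at h
  refine h.trans (mul_le_mul_of_nonneg_left (energy_comp_fold_le n u) ?_)
  exact inv_nonneg.2 (conductance_pos n).le

theorem sq_average_bottom_sub_le (n : ℕ) (u : Plane → ℝ) :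
    (average n (u ∘ swap) - average n u) ^ 2 ≤ (conductance n)⁻¹ * (2 * energy n u) := by
  have h := sq_average_top_sub_le n (u ∘ reflY)
  rw [average_reflY, energy_comp_reflY] at h
  have e : (u ∘ reflY) ∘ reflY ∘ swap = u ∘ swap := by
    funext p
    simp [reflY_reflY]
  rwa [e] at h

/-! ### Ternary coordinates of cells -/

/-- The first integer coordinate of the cell `K_w`, in units of `3⁻ⁿ`. -/
def zx {n : ℕ} (w : W n) : ℤ := ∑ k : Fin n, 3 ^ (k.rev : ℕ) * dx (w k)

/-- The second integer coordinate of the cell `K_w`, in units of `3⁻ⁿ`. -/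
def zy {n : ℕ} (w : W n) : ℤ := ∑ k : Fin n, 3 ^ (k.rev : ℕ) * dy (w k)

theorem zx_cons {n : ℕ} (i : Fin 8) (w : W n) :
    zx (Fin.cons i w : W (n + 1)) = 3 ^ n * dx i + zx w := by
  simp [zx, Fin.sum_univ_succ]

theorem zy_cons {n : ℕ} (i : Fin 8) (w : W n) :
    zy (Fin.cons i w : W (n + 1)) = 3 ^ n * dy i + zy w := by
  simp [zy, Fin.sum_univ_succ]

theorem zx_snoc {n : ℕ} (i : Fin 8) (w : W n) :
    zx (Fin.snoc w i : W (n + 1)) = 3 * zx w + dx i := by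
  simp only [zx, Fin.sum_univ_castSucc, Fin.snoc_castSucc, Fin.snoc_last, Finset.mul_sum]
  simp [Fin.rev_castSucc, pow_succ', mul_assoc]

theorem zy_snoc {n : ℕ} (i : Fin 8) (w : W n) :
    zy (Fin.snoc w i : W (n + 1)) = 3 * zy w + dy i := by
  simp only [zy, Fin.sum_univ_castSucc, Fin.snoc_castSucc, Fin.snoc_last, Finset.mul_sum]
  simp [Fin.rev_castSucc, pow_succ', mul_assoc]

theorem fw_zero {n : ℕ} (w : W n) (p : Plane) : fw w p 0 = (p 0 + zx w) / 3 ^ n := by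
  induction n with
  | zero => simp [fw, zx]
  | succ n ih =>
    obtain ⟨i, v, rfl⟩ : ∃ i v, w = Fin.cons i v := ⟨w 0, Fin.tail w, by simp⟩
    rw [fw_cons, f_zero, ih, zx_cons]
    push_cast
    field_simp
    ring

theorem fw_one {n : ℕ} (w : W n) (p : Plane) : fw w p 1 = (p 1 + zy w) / 3 ^ n := by
  induction n with
  | zero => simp [fw, zy]
  | succ n ih =>
    obtain ⟨i, v, rfl⟩ : ∃ i v, w = Fin.cons i v := ⟨w 0, Fin.tail w, by simp⟩
    rw [fw_cons, f_one, ih, zy_cons]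
    push_cast
    field_simp
    ring

theorem fw_eq_fw {n : ℕ} {w v : W n} {p q : Plane} (h0 : p 0 + zx w = q 0 + zx v)
    (h1 : p 1 + zy w = q 1 + zy v) : fw w p = fw v q :=
  plane_ext (by rw [fw_zero, fw_zero, h0]) (by rw [fw_one, fw_one, h1])

theorem add_eq_of_fw_eq_fw {n : ℕ} {w v : W n} {p q : Plane} (h : fw w p = fw v q) :
    p 0 + zx w = q 0 + zx v ∧ p 1 + zy w = q 1 + zy v := by
  have h0 := congrArg (fun x : Plane => x 0) h
  have h1 := congrArg (fun x : Plane => x 1) h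
  simp only [fw_zero, fw_one] at h0 h1
  have : (3 : ℝ) ^ n ≠ 0 := by positivity
  exact ⟨by field_simp at h0; exact h0, by field_simp at h1; exact h1⟩

theorem letter_ext {i j : Fin 8} (h0 : dx i = dx j) (h1 : dy i = dy j) : i = j := by
  revert i j; decide

theorem word_ext {n : ℕ} {w v : W n} (h0 : zx w = zx v) (h1 : zy w = zy v) : w = v := by
  induction n with
  | zero => exact Subsingleton.elim _ _
  | succ n ih =>
    obtain ⟨w, i, rfl⟩ : ∃ v i, w = Fin.snoc v i := ⟨Fin.init w, w (Fin.last n), by simp⟩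
    obtain ⟨v, j, rfl⟩ : ∃ w i, v = Fin.snoc w i := ⟨Fin.init v, v (Fin.last n), by simp⟩
    rw [zx_snoc, zx_snoc] at h0
    rw [zy_snoc, zy_snoc] at h1
    have := dx_mem i
    have := dx_mem j
    have := dy_mem i
    have := dy_mem j
    rw [ih (w := w) (v := v) (by omega) (by omega),
      letter_ext (i := i) (j := j) (by omega) (by omega)]

theorem zx_nonneg {n : ℕ} (w : W n) : 0 ≤ zx w :=
  Finset.sum_nonneg fun k _ => mul_nonneg (by positivity) (dx_mem _).1

theorem zx_lt {n : ℕ} (w : W n) : zx w < 3 ^ n := by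
  induction n with
  | zero => simp [zx]
  | succ n ih =>
    obtain ⟨w, i, rfl⟩ : ∃ v i, w = Fin.snoc v i := ⟨Fin.init w, w (Fin.last n), by simp⟩
    rw [zx_snoc, pow_succ]
    have := ih w
    have := dx_mem i
    omega

/-- The integer pairs that are coordinates of cells: no ternary digit is `1` in both entries. -/
def IsCoord : ℕ → ℤ → ℤ → Prop
  | 0, a, b => a = 0 ∧ b = 0
  | n + 1, a, b => IsCoord n (a / 3) (b / 3) ∧ ¬(a % 3 = 1 ∧ b % 3 = 1)

theorem isCoord_word {n : ℕ} (w : W n) : IsCoord n (zx w) (zy w) := by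
  induction n with
  | zero => simp [IsCoord, zx, zy]
  | succ n ih =>
    obtain ⟨w, i, rfl⟩ : ∃ v i, w = Fin.snoc v i := ⟨Fin.init w, w (Fin.last n), by simp⟩
    rw [zx_snoc, zy_snoc, IsCoord]
    have h1 := dx_mem i
    have h2 := dy_mem i
    have h3 : ¬(dx i = 1 ∧ dy i = 1) := by revert i; decide
    have e1 : (3 * zx w + dx i) / 3 = zx w := by omega
    have e2 : (3 * zy w + dy i) / 3 = zy w := by omega
    rw [e1, e2]
    exact ⟨ih w, by omega⟩

theorem exists_letter {a b : ℤ} (ha : 0 ≤ a ∧ a ≤ 2) (hb : 0 ≤ b ∧ b ≤ 2)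
    (h : ¬(a = 1 ∧ b = 1)) : ∃ i, dx i = a ∧ dy i = b := by
  obtain ⟨ha, ha'⟩ := ha
  obtain ⟨hb, hb'⟩ := hb
  interval_cases a <;> interval_cases b <;> first | omega | decide

theorem exists_word {n : ℕ} {a b : ℤ} (h : IsCoord n a b) : ∃ w : W n, zx w = a ∧ zy w = b := by
  induction n generalizing a b with
  | zero => exact ⟨fun _ => 0, by simp [zx, h.1], by simp [zy, h.2]⟩
  | succ n ih =>
    obtain ⟨w, hw0, hw1⟩ := ih h.1
    obtain ⟨i, hi0, hi1⟩ := exists_letter (a := a % 3) (b := b % 3) (by omega) (by omega) h.2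
    refine ⟨Fin.snoc w i, ?_, ?_⟩
    · rw [zx_snoc]
      omega
    · rw [zy_snoc]
      omega

/-- Look at the last ternary digits. If neither coordinate carries, the four squares have the same
parent and at most one of them is the removed centre. If exactly one carries, the square obtained by
changing that coordinate lies in the parent of the second square and has a digit 0 there. If both
carry, the parents are in the same diagonal position and induction applies. -/
theorem isCoord_diag {n : ℕ} {a b : ℤ} (h : IsCoord n a b) (h' : IsCoord n (a + 1) (b + 1)) :
    IsCoord n (a + 1) b ∨ IsCoord n a (b + 1) := by
  induction n generalizing a b with
  | zero =>
    simp only [IsCoord] at h h'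
    omega
  | succ n ih =>
    simp only [IsCoord] at h h' ⊢
    obtain ⟨h, hm⟩ := h
    obtain ⟨h', hm'⟩ := h'
    have ea : (a + 1) / 3 = a / 3 ∧ a % 3 ≠ 2 ∧ (a + 1) % 3 = a % 3 + 1 ∨
        (a + 1) / 3 = a / 3 + 1 ∧ a % 3 = 2 ∧ (a + 1) % 3 = 0 := by omega
    have eb : (b + 1) / 3 = b / 3 ∧ b % 3 ≠ 2 ∧ (b + 1) % 3 = b % 3 + 1 ∨
        (b + 1) / 3 = b / 3 + 1 ∧ b % 3 = 2 ∧ (b + 1) % 3 = 0 := by omega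
    obtain ⟨ea, ha, ha'⟩ | ⟨ea, ha, ha'⟩ := ea <;> obtain ⟨eb, hb, hb'⟩ | ⟨eb, hb, hb'⟩ := eb <;>
      rw [ea, eb] at h' <;> rw [ea, eb]
    · simp only [h, true_and]
      omega
    · exact Or.inr ⟨h', by omega⟩
    · exact Or.inl ⟨h', by omega⟩
    · exact (ih h h').imp (fun k => ⟨k, by omega⟩) fun k => ⟨k, by omega⟩

theorem isCoord_antidiag {n : ℕ} {a b : ℤ} (h : IsCoord n a b) (h' : IsCoord n (a + 1) (b - 1)) :
    IsCoord n (a + 1) b ∨ IsCoord n a (b - 1) := by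
  induction n generalizing a b with
  | zero =>
    simp only [IsCoord] at h h'
    omega
  | succ n ih =>
    simp only [IsCoord] at h h' ⊢
    obtain ⟨h, hm⟩ := h
    obtain ⟨h', hm'⟩ := h'
    have ea : (a + 1) / 3 = a / 3 ∧ a % 3 ≠ 2 ∧ (a + 1) % 3 = a % 3 + 1 ∨
        (a + 1) / 3 = a / 3 + 1 ∧ a % 3 = 2 ∧ (a + 1) % 3 = 0 := by omega
    have eb : (b - 1) / 3 = b / 3 ∧ b % 3 ≠ 0 ∧ (b - 1) % 3 = b % 3 - 1 ∨
        (b - 1) / 3 = b / 3 - 1 ∧ b % 3 = 0 ∧ (b - 1) % 3 = 2 := by omega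
    obtain ⟨ea, ha, ha'⟩ | ⟨ea, ha, ha'⟩ := ea <;> obtain ⟨eb, hb, hb'⟩ | ⟨eb, hb, hb'⟩ := eb <;>
      rw [ea, eb] at h' <;> rw [ea, eb]
    · simp only [h, true_and]
      omega
    · exact Or.inr ⟨h', by omega⟩
    · exact Or.inl ⟨h', by omega⟩
    · exact (ih h h').imp (fun k => ⟨k, by omega⟩) fun k => ⟨k, by omega⟩

/-! ### Neighbouring cells and sums over neighbourhoods -/

/-- The squares of two words share a side. -/
def SideAdj {n : ℕ} (w v : W n) : Prop :=
  zx v = zx w ∧ (zy v = zy w + 1 ∨ zy w = zy v + 1) ∨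
    zy v = zy w ∧ (zx v = zx w + 1 ∨ zx w = zx v + 1)

/-- The squares of two words intersect. -/
def Near {n : ℕ} (w v : W n) : Prop :=
  (zx v ≤ zx w + 1 ∧ zx w ≤ zx v + 1) ∧ zy v ≤ zy w + 1 ∧ zy w ≤ zy v + 1

theorem SideAdj.symm {n : ℕ} {w v : W n} (h : SideAdj w v) : SideAdj v w := by
  unfold SideAdj at *
  omega

theorem Near.symm {n : ℕ} {w v : W n} (h : Near w v) : Near v w := by
  unfold Near at *
  omega

theorem Near.refl {n : ℕ} (w : W n) : Near w w := by
  simp [Near]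

theorem SideAdj.near {n : ℕ} {w v : W n} (h : SideAdj w v) : Near w v := by
  unfold SideAdj at h
  unfold Near
  omega

theorem near_of_fw_eq_fw {n : ℕ} {w v : W n} {p q : Plane} (hp : p ∈ sq) (hq : q ∈ sq)
    (h : fw w p = fw v q) : Near w v := by
  obtain ⟨h0, h1⟩ := add_eq_of_fw_eq_fw h
  obtain ⟨⟨a1, a2⟩, a3, a4⟩ := hp
  obtain ⟨⟨b1, b2⟩, b3, b4⟩ := hq
  have h (x y : ℤ) (hx : (x : ℝ) ≤ y + 1) : x ≤ y + 1 := by exact_mod_cast hx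
  refine ⟨⟨h _ _ ?_, h _ _ ?_⟩, h _ _ ?_, h _ _ ?_⟩ <;> linarith

/-- Cells that touch only at a corner have a common side neighbour, by `isCoord_diag` and
`isCoord_antidiag`; so estimates across sides extend to all intersecting cells in two steps. -/
theorem Near.cases {n : ℕ} {w v : W n} (h : Near w v) :
    w = v ∨ SideAdj w v ∨ ∃ x, SideAdj w x ∧ SideAdj x v := by
  have key : ∀ w v : W n, Near w v → zx w < zx v → SideAdj w v ∨ ∃ x, SideAdj w x ∧ SideAdj x v := by
    intro w v h hlt
    unfold SideAdj
    unfold Near at h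
    have e0 : zx v = zx w + 1 := by omega
    obtain e1 | e1 | e1 : zy v = zy w ∨ zy v = zy w + 1 ∨ zy v = zy w - 1 := by omega
    · left
      omega
    · right
      have hv := isCoord_word v
      rw [e0, e1] at hv
      obtain hx | hx := isCoord_diag (isCoord_word w) hv <;> obtain ⟨x, h0, h1⟩ := exists_word hx <;>
        exact ⟨x, by omega, by omega⟩
    · right
      have hv := isCoord_word v
      rw [e0, e1] at hv
      obtain hx | hx := isCoord_antidiag (isCoord_word w) hv <;>
        obtain ⟨x, h0, h1⟩ := exists_word hx <;> exact ⟨x, by omega, by omega⟩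
  obtain hlt | he | hgt := lt_trichotomy (zx w) (zx v)
  · exact Or.inr (key w v h hlt)
  · by_cases e : zy w = zy v
    · exact Or.inl (word_ext he e)
    · right; left
      unfold SideAdj
      unfold Near at h
      omega
  · obtain h' | ⟨x, h1, h2⟩ := key v w h.symm hgt
    · exact Or.inr (Or.inl h'.symm)
    · exact Or.inr (Or.inr ⟨x, h2.symm, h1.symm⟩)

open Classical in
theorem card_near_le {n : ℕ} (w : W n) : (Finset.univ.filter fun v => Near w v).card ≤ 9 := by
  have h := Finset.card_le_card_of_injOn (s := Finset.univ.filter fun v : W n => Near w v)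
    (t := Finset.Icc (-1 : ℤ) 1 ×ˢ Finset.Icc (-1 : ℤ) 1) (fun v => (zx v - zx w, zy v - zy w))
    (fun v hv => by
      simp only [Finset.coe_filter, Finset.mem_univ, true_and, Set.mem_ofPred_eq] at hv
      simp only [Finset.coe_product, Finset.coe_Icc, Set.mem_prod, Set.mem_Icc]
      unfold Near at hv
      omega)
    (fun v _ v' _ hvv => by
      simp only [Prod.mk.injEq] at hvv
      exact word_ext (by omega) (by omega))
  exact h.trans (by decide)

open Classical in
/-- The sum of `e` over the words near `w`. -/
noncomputable def nearSum {n : ℕ} (e : W n → ℝ) (w : W n) : ℝ :=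
  ∑ v, if Near w v then e v else 0

theorem sum_nearSum_le {n : ℕ} {e : W n → ℝ} (he : ∀ w, 0 ≤ e w) :
    ∑ w, nearSum e w ≤ 9 * ∑ w, e w := by
  classical
  simp only [nearSum]
  rw [Finset.sum_comm, Finset.mul_sum]
  refine Finset.sum_le_sum fun v _ => ?_
  have h : ∀ w : W n, Near w v ↔ Near v w := fun w => ⟨Near.symm, Near.symm⟩
  simp only [h]
  rw [← Finset.sum_filter, Finset.sum_const, nsmul_eq_mul]
  exact mul_le_mul_of_nonneg_right (by exact_mod_cast card_near_le v) (he v)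

theorem le_nearSum {n : ℕ} {e : W n → ℝ} (he : ∀ w, 0 ≤ e w) {w v : W n} (h : Near w v) :
    e v ≤ nearSum e w := by
  classical
  have := Finset.single_le_sum (f := fun v => if Near w v then e v else 0)
    (fun v _ => by split_ifs <;> simp [he]) (Finset.mem_univ v)
  simpa [nearSum, h] using this

theorem nearSum_nonneg {n : ℕ} {e : W n → ℝ} (he : ∀ w, 0 ≤ e w) (w : W n) : 0 ≤ nearSum e w :=
  (he w).trans (le_nearSum he (Near.refl w))

/-- At most two steps across sides are needed: the square of a sum of two costs a factor 2, and four
terms of `e` appear, each at most `nearSum e w`. -/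
theorem sq_sub_le_nearSum {n : ℕ} {e U : W n → ℝ} (he : ∀ w, 0 ≤ e w)
    (hU : ∀ w v, SideAdj w v → (U w - U v) ^ 2 ≤ e w + e v) {w v : W n} (h : Near w v) :
    (U v - U w) ^ 2 ≤ 8 * nearSum e w := by
  have hw := le_nearSum he (Near.refl w)
  have hv := le_nearSum he h
  have hn := nearSum_nonneg he w
  obtain rfl | h' | ⟨x, h1, h2⟩ := h.cases
  · rw [sub_self]
    linarith
  · have := hU w v h'
    nlinarith
  · have e1 := hU w x h1
    have e2 := hU x v h2
    have hx := le_nearSum he h1.near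
    nlinarith [sq_nonneg ((U w - U x) - (U x - U v))]

/-- Each edge difference squared is at most `2 * (8 + 8) = 32` times `nearSum`; a cell has 8 edges
and a word is near at most 9 words, whence `2304 = 9 * 8 * 32`. -/
theorem energy_le_of_near {n : ℕ} {e U : W n → ℝ} (he : ∀ w, 0 ≤ e w) {u : Plane → ℝ}
    (h : ∀ w i, (u (fw w (pt i)) - U w) ^ 2 ≤ 8 * nearSum e w) :
    energy n u ≤ 2304 * ∑ w, e w := by
  calc energy n u ≤ ∑ w, 256 * nearSum e w := by
        rw [energy_eq_sum]
        refine Finset.sum_le_sum fun w _ => ?_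
        rw [energy_zero]
        refine (Finset.sum_le_card_nsmul _ _ (32 * nearSum e w) fun i _ => ?_).trans ?_
        · have h1 := h w i
          have h2 := h w (i + 1)
          simp only [Function.comp]
          nlinarith [sq_nonneg ((u (fw w (pt i)) - U w) + (u (fw w (pt (i + 1))) - U w))]
        · simp only [Finset.card_univ, Fintype.card_fin, nsmul_eq_mul]
          push_cast
          linarith
    _ ≤ 2304 * ∑ w, e w := by
        rw [← Finset.mul_sum]
        linarith [sum_nearSum_le he]

/-! ### Chains of cells -/

theorem two_mul_zx_const (n : ℕ) (i : Fin 8) : 2 * zx (constWord n i) = dx i * (3 ^ n - 1) := by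
  induction n with
  | zero => simp [zx]
  | succ n ih =>
    have : constWord (n + 1) i = Fin.cons i (constWord n i) := by
      funext k; refine Fin.cases ?_ (fun k => ?_) k <;> simp [constWord]
    rw [this, zx_cons, mul_add, ih]
    ring

theorem two_mul_zy_const (n : ℕ) (i : Fin 8) : 2 * zy (constWord n i) = dy i * (3 ^ n - 1) := by
  induction n with
  | zero => simp [zy]
  | succ n ih =>
    have : constWord (n + 1) i = Fin.cons i (constWord n i) := by
      funext k; refine Fin.cases ?_ (fun k => ?_) k <;> simp [constWord]
    rw [this, zy_cons, mul_add, ih]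
    ring

/-- The letters `a` and `b` are chosen on the facing sides of the subsquares `i` and `i + 1`,
opposite each other; repeating them reaches the common side at every depth. -/
theorem exists_sideAdj_cons (n : ℕ) (i : Fin 8) :
    ∃ w v : W n, SideAdj (Fin.cons i w : W (n + 1)) (Fin.cons (i + 1) v : W (n + 1)) := by
  obtain ⟨a, b, h0, h1, h⟩ : ∃ a b : Fin 8, 2 * (dx (i + 1) - dx i) = dx a - dx b ∧
      2 * (dy (i + 1) - dy i) = dy a - dy b ∧ (dx (i + 1) = dx i ∧ (dy (i + 1) = dy i + 1 ∨ dy i = dy (i + 1) + 1) ∨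
      dy (i + 1) = dy i ∧ (dx (i + 1) = dx i + 1 ∨ dx i = dx (i + 1) + 1)) := by
    revert i; decide
  refine ⟨constWord n a, constWord n b, ?_⟩
  have hx : zx (Fin.cons (i + 1) (constWord n b) : W (n + 1)) -
      zx (Fin.cons i (constWord n a) : W (n + 1)) = dx (i + 1) - dx i := by
    rw [zx_cons, zx_cons]
    have := two_mul_zx_const n a
    have := two_mul_zx_const n b
    have : 2 * (dx (i + 1) - dx i) * (3 ^ n - 1) = (dx a - dx b) * (3 ^ n - 1) := by rw [h0]
    linarith
  have hy : zy (Fin.cons (i + 1) (constWord n b) : W (n + 1)) -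
      zy (Fin.cons i (constWord n a) : W (n + 1)) = dy (i + 1) - dy i := by
    rw [zy_cons, zy_cons]
    have := two_mul_zy_const n a
    have := two_mul_zy_const n b
    have : 2 * (dy (i + 1) - dy i) * (3 ^ n - 1) = (dy a - dy b) * (3 ^ n - 1) := by rw [h1]
    linarith
  unfold SideAdj
  omega

theorem exists_chain_const (n : ℕ) : ∃ C : ℝ, 0 ≤ C ∧ ∀ (U : W n → ℝ) (t : ℝ), 0 ≤ t →
    (∀ w v, SideAdj w v → |U w - U v| ≤ t) → ∀ w v, |U w - U v| ≤ C * t := by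
  induction n with
  | zero =>
    refine ⟨0, le_rfl, fun U t _ _ w v => ?_⟩
    rw [Subsingleton.elim w v]
    simp
  | succ n ih =>
    obtain ⟨C, hC, h⟩ := ih
    -- The eight subcells form a ring: at most seven crossings, each costing `t`, and a walk of cost
    -- `C * t` inside each subcell visited.
    refine ⟨8 * (2 * C + 1), by positivity, fun U t ht hU => ?_⟩
    have h1 : ∀ i (w v : W n), |U (Fin.cons i w) - U (Fin.cons i v)| ≤ C * t := fun i =>
      h (fun w => U (Fin.cons i w)) t ht fun w v hwv => hU _ _ (by
        simpa [SideAdj, zx_cons, zy_cons, add_assoc] using hwv)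
    have h2 : ∀ (k : ℕ) (i : Fin 8) (w v : W n),
        |U (Fin.cons i w) - U (Fin.cons (i + Fin.ofNat 8 k) v)| ≤ (k + 1) * ((2 * C + 1) * t) := by
      intro k
      induction k with
      | zero =>
        intro i w v
        have := h1 i w v
        have e : i + Fin.ofNat 8 0 = i := by simp
        rw [e, Nat.cast_zero]
        nlinarith [mul_nonneg hC ht]
      | succ k ihk =>
        intro i w v
        obtain ⟨x, y, hxy⟩ := exists_sideAdj_cons n (i + Fin.ofNat 8 k)
        have a1 := ihk i w x
        have a2 := hU _ _ hxy
        have a3 := h1 (i + Fin.ofNat 8 k + 1) y v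
        have e : i + Fin.ofNat 8 (k + 1) = i + Fin.ofNat 8 k + 1 := by
          rw [add_assoc]
          congr 1
          ext
          simp [Fin.val_add]
        rw [e]
        push_cast
        have b1 := abs_sub_le (U (Fin.cons i w)) (U (Fin.cons (i + Fin.ofNat 8 k) x))
          (U (Fin.cons (i + Fin.ofNat 8 k + 1) v))
        have b2 := abs_sub_le (U (Fin.cons (i + Fin.ofNat 8 k) x))
          (U (Fin.cons (i + Fin.ofNat 8 k + 1) y)) (U (Fin.cons (i + Fin.ofNat 8 k + 1) v))
        nlinarith [mul_nonneg hC ht]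
    intro w v
    have h3 := h2 (v 0 - w 0 : Fin 8) (w 0) (Fin.tail w) (Fin.tail v)
    have e : w 0 + Fin.ofNat 8 ((v 0 - w 0 : Fin 8) : ℕ) = v 0 := by simp
    rw [e, Fin.cons_self_tail, Fin.cons_self_tail] at h3
    refine h3.trans ?_
    have : (((v 0 - w 0 : Fin 8) : ℕ) : ℝ) + 1 ≤ 8 := by
      have := (v 0 - w 0 : Fin 8).isLt
      exact_mod_cast this
    nlinarith [mul_nonneg hC ht, mul_le_mul_of_nonneg_right this
      (show 0 ≤ (2 * C + 1) * t by positivity)]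

/-! ### Geometry of the carpet and adjacency of cells -/

/-- A point of `K` farthest from `L` is the image of a point of `K` under some `f i`, and `f i`
shrinks the distance to `L` by a factor 3; so that distance is 0. One inclusion for each set
suffices, which allows `L` to be the square and `K` to be its boundary. -/
theorem subset_of_selfSimilar {K L : Set Plane} (hKc : IsCompact K) (hK : K ⊆ ⋃ i, f i '' K)
    (hLc : IsCompact L) (hLn : L.Nonempty) (hL : ∀ i, ∀ p ∈ L, f i p ∈ L) : K ⊆ L := by
  obtain rfl | hKn := K.eq_empty_or_nonempty
  · exact Set.empty_subset _
  obtain ⟨x, hx, hmax⟩ := hKc.exists_isMaxOn hKn (Metric.continuous_infDist_pt L).continuousOn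
  have hzero : Metric.infDist x L ≤ 0 := by
    obtain ⟨i, y, hy, rfl⟩ : ∃ i, ∃ y ∈ K, f i y = x := by simpa using hK hx
    obtain ⟨z, hz, hzd⟩ := hLc.exists_infDist_eq_dist hLn y
    have h1 : Metric.infDist (f i y) L ≤ 3⁻¹ * Metric.infDist y L := by
      rw [hzd, ← dist_f i]
      exact Metric.infDist_le_dist_of_mem (hL i z hz)
    have h2 : Metric.infDist y L ≤ Metric.infDist (f i y) L := hmax hy
    have h3 : 0 ≤ Metric.infDist y L := Metric.infDist_nonneg
    linarith
  intro y hy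
  rw [hLc.isClosed.mem_iff_infDist_zero hLn]
  exact le_antisymm ((hmax hy).trans hzero) Metric.infDist_nonneg

theorem isCompact_sq : IsCompact sq := by
  have h : sq = (fun v : Fin 2 → ℝ => WithLp.toLp 2 v) ''
      Set.pi Set.univ fun _ => Set.Icc (0 : ℝ) 1 := by
    ext p
    constructor
    · rintro ⟨h0, h1⟩
      refine ⟨p.ofLp, fun i _ => ?_, rfl⟩
      fin_cases i
      · exact h0
      · exact h1
    · rintro ⟨v, hv, rfl⟩
      exact ⟨hv 0 trivial, hv 1 trivial⟩
  rw [h]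
  exact (isCompact_univ_pi fun _ => isCompact_Icc).image (PiLp.continuous_toLp 2 _)

theorem carpet_subset_sq : carpet ⊆ sq :=
  subset_of_selfSimilar isCarpet_carpet.2.1 isCarpet_carpet.2.2.subset isCompact_sq
    ⟨pt 0, pt_mem_sq 0⟩ fun i _ hp => f_mem_sq i hp

/-- The boundary of the unit square. -/
def border : Set Plane := sq ∩ {p | (p 0 = 0 ∨ p 0 = 1) ∨ p 1 = 0 ∨ p 1 = 1}

theorem border_subset_carpet : border ⊆ carpet := by
  have hclosed : IsClosed {p : Plane | (p 0 = 0 ∨ p 0 = 1) ∨ p 1 = 0 ∨ p 1 = 1} := by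
    have h0 : Continuous fun p : Plane => p 0 := by fun_prop
    have h1 : Continuous fun p : Plane => p 1 := by fun_prop
    exact ((isClosed_eq h0 continuous_const).union (isClosed_eq h0 continuous_const)).union
      ((isClosed_eq h1 continuous_const).union (isClosed_eq h1 continuous_const))
  refine subset_of_selfSimilar (isCompact_sq.inter_right hclosed) ?_ isCarpet_carpet.2.1
    isCarpet_carpet.1 fun i p hp => ?_
  · have digit : ∀ t : ℝ, t ∈ Set.Icc (0 : ℝ) 1 →
        ∃ d : ℤ, (0 ≤ d ∧ d ≤ 2) ∧ 0 ≤ 3 * t - d ∧ 3 * t - d ≤ 1 := by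
      rintro t ⟨h0, h1⟩
      rcases le_total (3 * t) 1 with h | h
      · exact ⟨0, by norm_num, by push_cast; linarith, by push_cast; linarith⟩
      · rcases le_total (3 * t) 2 with h' | h'
        · exact ⟨1, by norm_num, by push_cast; linarith, by push_cast; linarith⟩
        · exact ⟨2, by norm_num, by push_cast; linarith, by push_cast; linarith⟩
    rintro p ⟨⟨h0, h1⟩, hb⟩
    obtain ⟨a, ha, ha0, ha1⟩ := digit _ h0
    obtain ⟨b, hb', hb0, hb1⟩ := digit _ h1
    have key : ∀ i, (0 ≤ 3 * p 0 - dx i ∧ 3 * p 0 - dx i ≤ 1) →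
        (0 ≤ 3 * p 1 - dy i ∧ 3 * p 1 - dy i ≤ 1) →
        ((3 * p 0 - dx i = 0 ∨ 3 * p 0 - dx i = 1) ∨ 3 * p 1 - dy i = 0 ∨ 3 * p 1 - dy i = 1) →
        p ∈ ⋃ i, f i '' border := by
      intro i k0 k1 kb
      refine Set.mem_iUnion.2 ⟨i, !₂[3 * p 0 - dx i, 3 * p 1 - dy i], ⟨⟨k0, k1⟩, kb⟩, ?_⟩
      refine plane_ext ?_ ?_
      · rw [f_zero]; simp
      · rw [f_one]; simp
    obtain (e | e) | (e | e) := hb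
    · obtain ⟨i, i0, i1⟩ := exists_letter (a := 0) (b := b) (by norm_num) hb' (by simp)
      apply key i <;> simp [i0, i1, e, hb0, hb1]
    · obtain ⟨i, i0, i1⟩ := exists_letter (a := 2) (b := b) (by norm_num) hb' (by simp)
      apply key i <;> norm_num [i0, i1, e, hb0, hb1]
    · obtain ⟨i, i0, i1⟩ := exists_letter (a := a) (b := 0) ha (by norm_num) (by simp)
      apply key i <;> simp [i0, i1, e, ha0, ha1]
    · obtain ⟨i, i0, i1⟩ := exists_letter (a := a) (b := 2) ha (by norm_num) (by simp)
      apply key i <;> norm_num [i0, i1, e, ha0, ha1]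
  · rw [isCarpet_carpet.2.2]
    exact Set.mem_iUnion.2 ⟨i, p, hp, rfl⟩

theorem dimH_eq_one_of_segment {S : Set Plane} {g : ℝ → Plane} (hg : Isometry g) {a b : ℝ}
    (hab : a < b) (h1 : S ⊆ Set.range g) (h2 : g '' Set.Icc a b ⊆ S) : dimH S = 1 := by
  refine le_antisymm ?_ ?_
  · refine (dimH_mono h1).trans ?_
    rw [← Set.image_univ, hg.dimH_image, Real.dimH_univ]
  · refine le_trans ?_ (dimH_mono h2)
    rw [hg.dimH_image, Real.dimH_of_nonempty_interior (by simp [hab])]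
    simp

theorem isometry_vertical (c : ℝ) : Isometry fun t : ℝ => (!₂[c, t] : Plane) :=
  Isometry.of_dist_eq fun s t => by
    simp [EuclideanSpace.dist_eq, Fin.sum_univ_two, Real.sqrt_sq_eq_abs, Real.dist_eq]

theorem isometry_horizontal (c : ℝ) : Isometry fun t : ℝ => (!₂[t, c] : Plane) :=
  Isometry.of_dist_eq fun s t => by
    simp [EuclideanSpace.dist_eq, Fin.sum_univ_two, Real.sqrt_sq_eq_abs, Real.dist_eq]

theorem AdjW.symm {n : ℕ} {w v : W n} (h : AdjW w v) : AdjW v w := by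
  unfold AdjW at *
  rwa [Set.inter_comm]

theorem mem_cell_of_border {n : ℕ} {w : W n} {x y : ℝ} (hx : x ∈ Set.Icc (0 : ℝ) 1)
    (hy : y ∈ Set.Icc (0 : ℝ) 1) (h : (x = 0 ∨ x = 1) ∨ y = 0 ∨ y = 1) {p : Plane}
    (h0 : p 0 = (x + zx w) / 3 ^ n) (h1 : p 1 = (y + zy w) / 3 ^ n) : p ∈ cell w :=
  ⟨!₂[x, y], border_subset_carpet ⟨⟨hx, hy⟩, h⟩, plane_ext (by simp [fw_zero, h0])
    (by simp [fw_one, h1])⟩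

/-- The intersection lies on the line through the common side, and contains that whole side because
the carpet contains the boundary of the square. -/
theorem SideAdj.adjW {n : ℕ} {w v : W n} (h : SideAdj w v) : AdjW w v := by
  have h3 : (0 : ℝ) < 3 ^ n := by positivity
  have hor : ∀ w v : W n, zy v = zy w → zx v = zx w + 1 → AdjW w v := by
    intro w v e1 e0
    have e1' : (zy v : ℝ) = zy w := by exact_mod_cast e1
    have e0' : (zx v : ℝ) = zx w + 1 := by exact_mod_cast e0
    refine dimH_eq_one_of_segment (isometry_vertical ((1 + zx w) / 3 ^ n))
      (a := zy w / 3 ^ n) (b := (1 + zy w) / 3 ^ n) ?_ ?_ ?_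
    · gcongr
      linarith
    · rintro _ ⟨⟨p, hp, rfl⟩, ⟨q, hq, hqp⟩⟩
      obtain ⟨k0, -⟩ := add_eq_of_fw_eq_fw hqp
      have a1 := (carpet_subset_sq hp).1.2
      have a2 := (carpet_subset_sq hq).1.1
      refine ⟨fw w p 1, plane_ext ?_ (by simp)⟩
      have : p 0 = 1 := by linarith
      simp [fw_zero, this]
    · rintro _ ⟨t, ⟨ht0, ht1⟩, rfl⟩
      rw [div_le_iff₀ h3] at ht0
      rw [le_div_iff₀ h3] at ht1
      constructor
      · refine mem_cell_of_border (x := 1) (y := t * 3 ^ n - zy w) (by simp)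
          ⟨by linarith, by linarith⟩ (by simp) ?_ ?_ <;> simp
      · refine mem_cell_of_border (x := 0) (y := t * 3 ^ n - zy v) (by simp)
          ⟨by linarith, by linarith⟩ (by simp) ?_ ?_ <;> simp [e0', add_comm]
  have ver : ∀ w v : W n, zx v = zx w → zy v = zy w + 1 → AdjW w v := by
    intro w v e1 e0
    have e1' : (zx v : ℝ) = zx w := by exact_mod_cast e1
    have e0' : (zy v : ℝ) = zy w + 1 := by exact_mod_cast e0
    refine dimH_eq_one_of_segment (isometry_horizontal ((1 + zy w) / 3 ^ n))
      (a := zx w / 3 ^ n) (b := (1 + zx w) / 3 ^ n) ?_ ?_ ?_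
    · gcongr
      linarith
    · rintro _ ⟨⟨p, hp, rfl⟩, ⟨q, hq, hqp⟩⟩
      obtain ⟨-, k0⟩ := add_eq_of_fw_eq_fw hqp
      have a1 := (carpet_subset_sq hp).2.2
      have a2 := (carpet_subset_sq hq).2.1
      refine ⟨fw w p 0, plane_ext (by simp) ?_⟩
      have : p 1 = 1 := by linarith
      simp [fw_one, this]
    · rintro _ ⟨t, ⟨ht0, ht1⟩, rfl⟩
      rw [div_le_iff₀ h3] at ht0
      rw [le_div_iff₀ h3] at ht1
      constructor
      · refine mem_cell_of_border (y := 1) (x := t * 3 ^ n - zx w)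
          ⟨by linarith, by linarith⟩ (by simp) (by simp) ?_ ?_ <;> simp
      · refine mem_cell_of_border (y := 0) (x := t * 3 ^ n - zx v)
          ⟨by linarith, by linarith⟩ (by simp) (by simp) ?_ ?_ <;> simp [e0', add_comm]
  obtain ⟨e, e' | e'⟩ | ⟨e, e' | e'⟩ := h
  · exact ver w v e e'
  · exact (ver v w e.symm e').symm
  · exact hor w v e e'
  · exact (hor v w e.symm e').symm

/-- If two distinct cells meet without sharing a side, both integer coordinates differ by one, so
they meet in a single corner, of dimension 0. -/
theorem AdjW.sideAdj {n : ℕ} {w v : W n} (h : AdjW w v) (hne : w ≠ v) : SideAdj w v := by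
  by_contra hs
  have hsub : (cell w ∩ cell v).Subsingleton := by
    rintro _ ⟨⟨p, hp, rfl⟩, ⟨p', hp', hpp⟩⟩ _ ⟨⟨q, hq, rfl⟩, ⟨q', hq', hqq⟩⟩
    have hp := carpet_subset_sq hp
    have hp' := carpet_subset_sq hp'
    have hq := carpet_subset_sq hq
    have hq' := carpet_subset_sq hq'
    have hn := near_of_fw_eq_fw hp hp' hpp.symm
    obtain ⟨a0, a1⟩ := add_eq_of_fw_eq_fw hpp
    obtain ⟨b0, b1⟩ := add_eq_of_fw_eq_fw hqq
    have hx : zx v = zx w + 1 ∨ zx w = zx v + 1 := by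
      by_contra hc
      unfold SideAdj at hs
      unfold Near at hn
      have e0 : zx w = zx v := by omega
      by_cases e1 : zy w = zy v
      · exact hne (word_ext e0 e1)
      · omega
    have hy : zy v = zy w + 1 ∨ zy w = zy v + 1 := by
      unfold SideAdj at hs
      unfold Near at hn
      omega
    obtain ⟨⟨p1, p2⟩, p3, p4⟩ := hp
    obtain ⟨⟨p1', p2'⟩, p3', p4'⟩ := hp'
    obtain ⟨⟨q1, q2⟩, q3, q4⟩ := hq
    obtain ⟨⟨q1', q2'⟩, q3', q4'⟩ := hq'
    congr 1
    refine plane_ext ?_ ?_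
    · obtain hx | hx := hx
      · have : (zx v : ℝ) = zx w + 1 := by exact_mod_cast hx
        linarith
      · have : (zx w : ℝ) = zx v + 1 := by exact_mod_cast hx
        linarith
    · obtain hy | hy := hy
      · have : (zy v : ℝ) = zy w + 1 := by exact_mod_cast hy
        linarith
      · have : (zy w : ℝ) = zy v + 1 := by exact_mod_cast hy
        linarith
  have := hsub.dimH_zero
  rw [AdjW, this] at h
  exact zero_ne_one h

/-! ### Interpolation and the upper bounds for the conductance -/

/-- The point `(a, b) / 3ⁿ`. -/
noncomputable def gridPt (n : ℕ) (a b : ℤ) : Plane := !₂[(a : ℝ) / 3 ^ n, (b : ℝ) / 3 ^ n]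

/-- The interpolation of the corner values of `U` in the grid square with lower left corner
`(a, b) / 3ⁿ`; the argument is relative to that square. -/
noncomputable def cellInterp (m n : ℕ) (U : Plane → ℝ) (a b : ℤ) (p : Plane) : ℝ :=
  U (gridPt n a b) * ((1 - potential m p) * (1 - potential m (swap p))) +
  U (gridPt n (a + 1) b) * (potential m p * (1 - potential m (swap p))) +
  U (gridPt n a (b + 1)) * ((1 - potential m p) * potential m (swap p)) +
  U (gridPt n (a + 1) (b + 1)) * (potential m p * potential m (swap p))

/-- The interpolation of the values of `U` on the grid `3⁻ⁿ ℤ²`. -/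
noncomputable def interp (m n : ℕ) (U : Plane → ℝ) (q : Plane) : ℝ :=
  cellInterp m n U ⌊q 0 * 3 ^ n⌋ ⌊q 1 * 3 ^ n⌋ !₂[Int.fract (q 0 * 3 ^ n), Int.fract (q 1 * 3 ^ n)]

/-- On a vertical side only `potential m (swap p)` enters, and the symmetry under `reflY` gives it
the same values on the right side of one square as on the left side of the next. -/
theorem cellInterp_right (m n : ℕ) (U : Plane → ℝ) (a b : ℤ) {p p' : Plane} (h0 : p 0 = 1)
    (h0' : p' 0 = 0) (h1 : p' 1 = p 1) :
    cellInterp m n U a b p = cellInterp m n U (a + 1) b p' := by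
  have e : potential m (swap p) = potential m (swap p') := by
    rw [← potential_reflY]
    exact congrArg _ (plane_ext (by simp [h1]) (by simp [h0, h0']))
  simp only [cellInterp, e, (potential_admissible m).2 p h0, (potential_admissible m).1 p' h0']
  ring

theorem cellInterp_top (m n : ℕ) (U : Plane → ℝ) (a b : ℤ) {p p' : Plane} (h0 : p 1 = 1)
    (h0' : p' 1 = 0) (h1 : p' 0 = p 0) :
    cellInterp m n U a b p = cellInterp m n U a (b + 1) p' := by
  have e : potential m p = potential m p' := by
    rw [← potential_reflY]
    exact congrArg _ (plane_ext (by simp [h1]) (by simp [h0, h0']))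
  simp only [cellInterp, e, (potential_admissible m).2 (swap p) h0,
    (potential_admissible m).1 (swap p') h0']
  ring

/-- The floor assigns the right and top sides of a square to its neighbours; the two matching lemmas
show that this does not change the value. -/
theorem cellInterp_fract (m n : ℕ) (U : Plane → ℝ) (a b : ℤ) {p : Plane} (hp : p ∈ sq) :
    cellInterp m n U (⌊p 0⌋ + a) (⌊p 1⌋ + b) !₂[Int.fract (p 0), Int.fract (p 1)] =
      cellInterp m n U a b p := by
  obtain ⟨⟨h1, h2⟩, h3, h4⟩ := hp
  have key : ∀ t : ℝ, 0 ≤ t → t < 1 → ⌊t⌋ = 0 ∧ Int.fract t = t := fun t a b =>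
    ⟨Int.floor_eq_zero_iff.2 ⟨a, b⟩, Int.fract_eq_self.2 ⟨a, b⟩⟩
  obtain hx | hx := h2.lt_or_eq <;> obtain hy | hy := h4.lt_or_eq
  · rw [(key _ h1 hx).1, (key _ h1 hx).2, (key _ h3 hy).1, (key _ h3 hy).2, zero_add, zero_add]
    exact congrArg _ (plane_ext (by simp) (by simp))
  · rw [(key _ h1 hx).1, (key _ h1 hx).2, hy, zero_add, Int.floor_one, Int.fract_one, add_comm 1 b]
    exact (cellInterp_top m n U a b hy (by simp) (by simp)).symm
  · rw [(key _ h3 hy).1, (key _ h3 hy).2, hx, zero_add, Int.floor_one, Int.fract_one, add_comm 1 a]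
    exact (cellInterp_right m n U a b hx (by simp) (by simp)).symm
  · rw [hx, hy, Int.floor_one, Int.fract_one, add_comm 1 a, add_comm 1 b]
    rw [cellInterp_right m n U a b (p' := !₂[0, 1]) hx (by simp) (by simp [hy])]
    exact (cellInterp_top m n U (a + 1) b (by simp) (by simp) (by simp)).symm

theorem interp_fw (m : ℕ) {n : ℕ} (U : Plane → ℝ) (w : W n) {p : Plane} (hp : p ∈ sq) :
    interp m n U (fw w p) = cellInterp m n U (zx w) (zy w) p := by
  have h3 : (3 : ℝ) ^ n ≠ 0 := by positivity
  rw [interp, fw_zero, fw_one, div_mul_cancel₀ _ h3, div_mul_cancel₀ _ h3, Int.floor_add_intCast,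
    Int.floor_add_intCast, Int.fract_add_intCast, Int.fract_add_intCast]
  exact cellInterp_fract m n U _ _ hp

theorem gridPt_corners {n : ℕ} (w : W n) : gridPt n (zx w) (zy w) = fw w (pt 0) ∧
    gridPt n (zx w + 1) (zy w) = fw w (pt 2) ∧ gridPt n (zx w + 1) (zy w + 1) = fw w (pt 4) ∧
    gridPt n (zx w) (zy w + 1) = fw w (pt 6) := by
  refine ⟨?_, ?_, ?_, ?_⟩ <;> refine plane_ext ?_ ?_ <;>
    simp [gridPt, fw_zero, fw_one, pt_zero, pt_one, add_comm]

theorem cellInterp_eq (m : ℕ) {n : ℕ} (U : Plane → ℝ) (w : W n) (p : Plane) :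
    cellInterp m n U (zx w) (zy w) p =
      U (fw w (pt 0)) * ((1 - potential m p) * (1 - potential m (swap p))) +
      U (fw w (pt 2)) * (potential m p * (1 - potential m (swap p))) +
      U (fw w (pt 6)) * ((1 - potential m p) * potential m (swap p)) +
      U (fw w (pt 4)) * (potential m p * potential m (swap p)) := by
  obtain ⟨h0, h2, h4, h6⟩ := gridPt_corners w
  rw [cellInterp, h0, h2, h4, h6]

theorem sq_bilinear_le {a b F s t h k : ℝ} (hh : h ∈ Set.Icc (0 : ℝ) 1)
    (hk : k ∈ Set.Icc (0 : ℝ) 1) : (a * s + b * t + F * (h * t + k * s)) ^ 2 ≤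
      (3 * a ^ 2 + 6 * F ^ 2) * s ^ 2 + (3 * b ^ 2 + 6 * F ^ 2) * t ^ 2 := by
  have h1 : ∀ x y z : ℝ, (x + y + z) ^ 2 ≤ 3 * (x ^ 2 + y ^ 2 + z ^ 2) := fun x y z => by
    linarith [sq_nonneg (x - y), sq_nonneg (x - z), sq_nonneg (y - z)]
  have hh2 : h ^ 2 ≤ 1 := pow_le_one₀ hh.1 hh.2
  have hk2 : k ^ 2 ≤ 1 := pow_le_one₀ hk.1 hk.2
  have h2 : (h * t + k * s) ^ 2 ≤ 2 * (t ^ 2 + s ^ 2) := by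
    linarith [sq_nonneg (h * t - k * s), mul_le_mul_of_nonneg_right hh2 (sq_nonneg t),
      mul_le_mul_of_nonneg_right hk2 (sq_nonneg s)]
  have h3 := mul_le_mul_of_nonneg_left h2 (sq_nonneg F)
  have h4 := h1 (a * s) (b * t) (F * (h * t + k * s))
  rw [mul_pow, mul_pow, mul_pow] at h4
  linarith

/-- With `F = A - B - C + D`, an increment is `(B - A) Δh + (C - A) Δk + F Δ(hk)`. Both `h` and `k`
have energy `conductance m` and values in `[0, 1]`, so the product is controlled by the increments
of its factors. -/
theorem energy_bilinear_le (m : ℕ) (A B C D : ℝ) :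
    energy m (fun p => A * ((1 - potential m p) * (1 - potential m (swap p))) +
      B * (potential m p * (1 - potential m (swap p))) +
      C * ((1 - potential m p) * potential m (swap p)) +
      D * (potential m p * potential m (swap p))) ≤
    conductance m * (27 * (B - A) ^ 2 + 3 * (C - A) ^ 2 + 24 * (D - C) ^ 2) := by
  have key : ∀ h k h' k' : ℝ, h ∈ Set.Icc (0 : ℝ) 1 → k' ∈ Set.Icc (0 : ℝ) 1 →
      ((A * ((1 - h) * (1 - k)) + B * (h * (1 - k)) + C * ((1 - h) * k) + D * (h * k)) -
      (A * ((1 - h') * (1 - k')) + B * (h' * (1 - k')) + C * ((1 - h') * k') + D * (h' * k'))) ^ 2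
      ≤ (3 * (B - A) ^ 2 + 6 * (A - B - C + D) ^ 2) * (h - h') ^ 2 +
        (3 * (C - A) ^ 2 + 6 * (A - B - C + D) ^ 2) * (k - k') ^ 2 := by
    intro h k h' k' hh hk
    refine le_of_eq_of_le ?_ (sq_bilinear_le (a := B - A) (b := C - A) (F := A - B - C + D)
      (s := h - h') (t := k - k') hh hk)
    ring
  have hF : (A - B - C + D) ^ 2 ≤ 2 * ((D - C) ^ 2 + (B - A) ^ 2) := by
    nlinarith [sq_nonneg ((D - C) + (B - A))]
  calc _ ≤ (3 * (B - A) ^ 2 + 6 * (A - B - C + D) ^ 2) * energy m (potential m) +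
        (3 * (C - A) ^ 2 + 6 * (A - B - C + D) ^ 2) * energy m (potential m ∘ swap) := by
        simp only [energy, Finset.mul_sum, ← Finset.sum_add_distrib]
        exact Finset.sum_le_sum fun x _ =>
          key _ _ _ _ (potential_mem_Icc m _) (potential_mem_Icc m _)
    _ = conductance m * (3 * (B - A) ^ 2 + 3 * (C - A) ^ 2 + 12 * (A - B - C + D) ^ 2) := by
        rw [energy_comp_swap, conductance]
        ring
    _ ≤ _ := mul_le_mul_of_nonneg_left (by linarith) (conductance_pos m).le

theorem energy_interp_comp_fw_le (m : ℕ) {n : ℕ} (U : Plane → ℝ) (w : W n) :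
    energy m (interp m n U ∘ fw w) ≤ 60 * conductance m * energy 0 (U ∘ fw w) := by
  have h : energy m (interp m n U ∘ fw w) = energy m (cellInterp m n U (zx w) (zy w)) :=
    energy_congr fun p hp => interp_fw m U w hp
  rw [h, funext (cellInterp_eq m U w)]
  refine (energy_bilinear_le m _ _ _ _).trans ?_
  rw [mul_assoc, mul_left_comm]
  refine mul_le_mul_of_nonneg_left ?_ (conductance_pos m).le
  rw [energy_zero, Fin.sum_univ_eight]
  simp only [Function.comp, Fin.reduceAdd]
  have key : ∀ a b c : ℝ, (c - a) ^ 2 ≤ 2 * ((a - b) ^ 2 + (b - c) ^ 2) := fun a b c => by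
    nlinarith [sq_nonneg ((a - b) - (b - c))]
  have h1 := key (U (fw w (pt 0))) (U (fw w (pt 1))) (U (fw w (pt 2)))
  have h2 := key (U (fw w (pt 6))) (U (fw w (pt 7))) (U (fw w (pt 0)))
  have h3 := key (U (fw w (pt 4))) (U (fw w (pt 5))) (U (fw w (pt 6)))
  have := sq_nonneg (U (fw w (pt 0)) - U (fw w (pt 1)))
  have := sq_nonneg (U (fw w (pt 1)) - U (fw w (pt 2)))
  have := sq_nonneg (U (fw w (pt 2)) - U (fw w (pt 3)))
  have := sq_nonneg (U (fw w (pt 3)) - U (fw w (pt 4)))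
  have := sq_nonneg (U (fw w (pt 4)) - U (fw w (pt 5)))
  have := sq_nonneg (U (fw w (pt 5)) - U (fw w (pt 6)))
  have := sq_nonneg (U (fw w (pt 6)) - U (fw w (pt 7)))
  have := sq_nonneg (U (fw w (pt 7)) - U (fw w (pt 0)))
  linarith

theorem energy_interp_le (m n : ℕ) (U : Plane → ℝ) :
    energy (m + n) (interp m n U) ≤ 60 * conductance m * energy n U := by
  rw [energy_add, energy_eq_sum n, Finset.mul_sum]
  exact Finset.sum_le_sum fun w _ => energy_interp_comp_fw_le m U w

theorem interp_admissible (m n : ℕ) {U : Plane → ℝ} (hU : U ∈ admissible) :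
    interp m n U ∈ admissible := by
  have h3 : (3 : ℝ) ^ n ≠ 0 := by positivity
  constructor
  · intro q hq
    have h : ∀ b, U (gridPt n ⌊q 0 * 3 ^ n⌋ b) = 0 := fun b => hU.1 _ (by simp [gridPt, hq])
    rw [interp, cellInterp, (potential_admissible m).1 _ (by simp [hq]), h, h]
    ring
  · intro q hq
    -- On the line `x = 1` the floor selects the square to the right of the unit square; its left
    -- corners lie on `x = 1`, where `U` is 1.
    have hf : ⌊(3 : ℝ) ^ n⌋ = 3 ^ n := by
      have := Int.floor_natCast (R := ℝ) (3 ^ n)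
      push_cast at this
      exact this
    have hf' : Int.fract ((3 : ℝ) ^ n) = 0 := by
      rw [Int.fract, hf]
      simp
    have h : ∀ b, U (gridPt n ⌊q 0 * 3 ^ n⌋ b) = 1 := fun b => hU.2 _ (by simp [gridPt, hq, hf])
    rw [interp, cellInterp, (potential_admissible m).1 _ (by simp [hq, hf']), h, h]
    ring

theorem conductance_add_le (m n : ℕ) :
    conductance (m + n) ≤ 60 * conductance m * conductance n :=
  (conductance_le _ (interp_admissible m n (potential_admissible n))).trans
    (energy_interp_le m n _)

/-- The three columns contain 3, 2 and 3 cells. Joining each column in parallel and the columns in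
series gives resistance `1/3 + 1/2 + 1/3 = 7/6` in units of a cell, with potentials 0, 2/7, 5/7, 1.
-/
theorem conductance_succ_le (m : ℕ) : conductance (m + 1) ≤ 6 / 7 * conductance m := by
  let U : Plane → ℝ := fun p =>
    if p 0 = 0 then 0 else if p 0 = 1 then 1 else if p 0 = 1 / 3 then 2 / 7 else 5 / 7
  have hU : U ∈ admissible := ⟨fun p hp => by simp [U, hp], fun p hp => by simp [U, hp]⟩
  refine (conductance_le _ (interp_admissible m 1 hU)).trans ?_
  have hfw : ∀ (i : Fin 8) (p : Plane), fw (fun _ : Fin 1 => i) p = f i p := fun i p => rfl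
  have hval : ∀ i : Fin 8, ∀ a b : ℝ, U (f i (pt 0)) = a → U (f i (pt 6)) = a →
      U (f i (pt 2)) = b → U (f i (pt 4)) = b →
      energy m (interp m 1 U ∘ f i) = (b - a) ^ 2 * conductance m := by
    intro i a b h0 h6 h2 h4
    rw [conductance, ← energy_affine m _ a]
    refine energy_congr fun p hp => ?_
    have := interp_fw m U (fun _ : Fin 1 => i) hp
    rw [cellInterp_eq] at this
    simp only [hfw, h0, h2, h4, h6] at this
    simp only [Function.comp]
    rw [this]
    ring
  rw [energy_succ, Fin.sum_univ_eight]
  rw [hval 0 0 (2 / 7), hval 1 (2 / 7) (5 / 7), hval 2 (5 / 7) 1, hval 3 (5 / 7) 1,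
    hval 4 (5 / 7) 1, hval 5 (2 / 7) (5 / 7), hval 6 0 (2 / 7), hval 7 0 (2 / 7)]
  · apply le_of_eq
    ring
  all_goals simp only [U, f_zero, pt_zero]; norm_num

/-- A function that separates `p_0` from the cell `f_1(K)`. -/
theorem exists_separating (m : ℕ) : ∃ u : Plane → ℝ, u (pt 0) = 0 ∧ (∀ p ∈ sq, u (f 1 p) = 1) ∧
    energy (m + 1) u ≤ 3840 * conductance m := by
  let U : Plane → ℝ := fun p => if p 0 = 0 then 0 else 1
  refine ⟨interp m 1 U, ?_, ?_, ?_⟩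
  · rw [interp, cellInterp, (potential_admissible m).1 _ (by simp [pt_zero])]
    simp [pt_zero, gridPt, U]
  · intro p hp
    have := interp_fw m U (fun _ : Fin 1 => 1) hp
    have hfw : ∀ (i : Fin 8) (p : Plane), fw (fun _ : Fin 1 => i) p = f i p := fun i p => rfl
    rw [cellInterp_eq] at this
    simp only [hfw] at this
    have h0 : U (f 1 (pt 0)) = 1 := by simp [U, f_zero, pt_zero]
    have h2 : U (f 1 (pt 2)) = 1 := by norm_num [U, f_zero, pt_zero]
    have h4 : U (f 1 (pt 4)) = 1 := by norm_num [U, f_zero, pt_zero]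
    have h6 : U (f 1 (pt 6)) = 1 := by simp [U, f_zero, pt_zero]
    rw [this, h0, h2, h4, h6]
    ring
  · refine (energy_interp_le m 1 U).trans ?_
    -- There are 64 edges at level 1, each contributing at most 1; and `60 * 64 = 3840`.
    have h : energy 1 U ≤ 64 := by
      refine (Finset.sum_le_card_nsmul _ _ 1 fun x _ => ?_).trans ?_
      · simp only [grad, U]
        split_ifs <;> norm_num
      · simp
    nlinarith [conductance_pos m]

/-! ### Averages over cells and the lower bounds for the conductance -/

theorem sq_average_sideAdj_le (m : ℕ) {n : ℕ} (u : Plane → ℝ) {w v : W n} (h : SideAdj w v) :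
    (average m (u ∘ fw w) - average m (u ∘ fw v)) ^ 2 ≤
      4 * (conductance m)⁻¹ * energy m (u ∘ fw w) +
        4 * (conductance m)⁻¹ * energy m (u ∘ fw v) := by
  have hc := inv_pos.2 (conductance_pos m)
  have hE : ∀ w : W n, 0 ≤ (conductance m)⁻¹ * energy m (u ∘ fw w) := fun w =>
    mul_nonneg hc.le (energy_nonneg _ _)
  have hor : ∀ w v : W n, zy v = zy w → zx v = zx w + 1 →
      (average m (u ∘ fw w) - average m (u ∘ fw v)) ^ 2 ≤
      4 * (conductance m)⁻¹ * energy m (u ∘ fw w) +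
        4 * (conductance m)⁻¹ * energy m (u ∘ fw v) := by
    intro w v e1 e0
    have k := sq_average_reflX_sub_le m (u ∘ fw w)
    have e : average m ((u ∘ fw w) ∘ reflX) = average m (u ∘ fw v) :=
      average_congr m fun p _ h0 => congrArg u (fw_eq_fw (by
        simp only [reflX_zero, e0, h0]; push_cast; ring) (by simp [e1]))
    rw [e] at k
    have := hE w
    have := hE v
    linarith
  have ver : ∀ w v : W n, zx v = zx w → zy v = zy w + 1 →
      (average m (u ∘ fw w) - average m (u ∘ fw v)) ^ 2 ≤
      4 * (conductance m)⁻¹ * energy m (u ∘ fw w) +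
        4 * (conductance m)⁻¹ * energy m (u ∘ fw v) := by
    intro w v e1 e0
    have k := sq_average_top_sub_le m (u ∘ fw w)
    have k' := sq_average_bottom_sub_le m (u ∘ fw v)
    have e : average m ((u ∘ fw w) ∘ reflY ∘ swap) = average m ((u ∘ fw v) ∘ swap) :=
      average_congr m fun p _ h0 => congrArg u (fw_eq_fw (by simp [e1]) (by
        simp only [Function.comp, reflY_one, swap_one, e0, h0]; push_cast; ring))
    rw [e] at k
    nlinarith [sq_nonneg ((average m ((u ∘ fw v) ∘ swap) - average m (u ∘ fw w)) +
      (average m ((u ∘ fw v) ∘ swap) - average m (u ∘ fw v)))]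
  obtain ⟨e, e' | e'⟩ | ⟨e, e' | e'⟩ := h
  · exact ver w v e e'
  · have := ver v w e.symm e'
    linarith
  · exact hor w v e e'
  · have := hor v w e.symm e'
    linarith

/-- A vertex may lie in several cells. It takes the value of any one of them, and all of them
intersect `w`. -/
theorem exists_extension {n : ℕ} (U : W n → ℝ) : ∃ u : Plane → ℝ, ∀ w i, ∃ v, Near w v ∧
    u (fw w (pt i)) = U v := by
  classical
  refine ⟨fun p => if h : ∃ v j, fw v (pt j) = p then U h.choose else 0, fun w i => ?_⟩
  have h : ∃ v j, fw v (pt j) = fw w (pt i) := ⟨w, i, rfl⟩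
  refine ⟨h.choose, ?_, by dsimp only; rw [dif_pos h]⟩
  obtain ⟨j, hj⟩ := h.choose_spec
  exact near_of_fw_eq_fw (pt_mem_sq i) (pt_mem_sq j) hj.symm

theorem conductance_mul_le (m n : ℕ) :
    conductance n * conductance m ≤ 9216 * conductance (m + n) := by
  have hc := conductance_pos m
  set u := potential (m + n)
  set U : W n → ℝ := fun w => average m (u ∘ fw w)
  set e : W n → ℝ := fun w => 4 * (conductance m)⁻¹ * energy m (u ∘ fw w)
  have he : ∀ w, 0 ≤ e w := fun w => mul_nonneg (by positivity) (energy_nonneg _ _)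
  have hU : ∀ w v, SideAdj w v → (U w - U v) ^ 2 ≤ e w + e v := fun w v h =>
    sq_average_sideAdj_le m u h
  obtain ⟨g, hg⟩ := exists_extension U
  let g' : Plane → ℝ := fun p => if p 0 = 0 then 0 else if p 0 = 1 then 1 else g p
  have hadm : g' ∈ admissible := ⟨fun p hp => by simp [g', hp], fun p hp => by simp [g', hp]⟩
  have h3 : (0 : ℝ) < 3 ^ n := by positivity
  have hbound : ∀ w i, (g' (fw w (pt i)) - U w) ^ 2 ≤ 8 * nearSum e w := by
    intro w i
    have hn := nearSum_nonneg he w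
    have hpt := (pt_mem_sq i).1
    simp only [g']
    split_ifs with h0 h1
    · have hz : (zx w : ℝ) = 0 := by
        rw [fw_zero, div_eq_zero_iff, or_iff_left h3.ne'] at h0
        have : (0 : ℝ) ≤ zx w := by exact_mod_cast zx_nonneg w
        linarith [hpt.1]
      have : U w = 0 := by
        rw [← average_const m 0]
        refine average_congr m fun p _ hp => (potential_admissible _).1 _ ?_
        simp [fw_zero, hz, hp]
      rw [this]
      linarith
    · have hz : (zx w : ℝ) + 1 = 3 ^ n := by
        rw [fw_zero, div_eq_one_iff_eq h3.ne'] at h1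
        have : (zx w : ℝ) + 1 ≤ 3 ^ n := by exact_mod_cast zx_lt w
        linarith [hpt.2]
      -- In the last column it is the average over the right side that equals 1; `U w` is the
      -- average over the left side, so one crossing of the cell is paid.
      have h2 : average m ((u ∘ fw w) ∘ reflX) = 1 := by
        rw [← average_const m 1]
        refine average_congr m fun p _ hp => (potential_admissible _).2 _ ?_
        rw [fw_zero, reflX_zero, hp, ← hz]
        rw [div_eq_one_iff_eq (by rw [hz]; exact h3.ne')]
        ring
      have h4 := sq_average_reflX_sub_le m (u ∘ fw w)
      rw [h2] at h4
      have h5 : e w ≤ nearSum e w := le_nearSum he (Near.refl w)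
      have h6 := he w
      simp only [e] at h5 h6
      linarith
    · obtain ⟨v, hv, hgv⟩ := hg w i
      rw [hgv]
      exact sq_sub_le_nearSum he hU hv
  have h := (conductance_le n hadm).trans (energy_le_of_near he hbound)
  have hs : ∑ w, e w = 4 * (conductance m)⁻¹ * conductance (m + n) := by
    rw [show conductance (m + n) = energy (m + n) u from rfl, energy_add, Finset.mul_sum]
  rw [hs] at h
  calc conductance n * conductance m ≤
      (2304 * (4 * (conductance m)⁻¹ * conductance (m + n))) * conductance m :=
        mul_le_mul_of_nonneg_right h hc.le
    _ = _ := by field_simp; ring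

theorem average_comp_f_reflX (m : ℕ) (u : Plane → ℝ) {i j : Fin 8} (h0 : dx j = dx i + 1)
    (h1 : dy j = dy i) : average m ((u ∘ f i) ∘ reflX) = average m (u ∘ f j) :=
  average_congr m fun p _ hp => congrArg u (plane_ext (by
    simp only [f_zero, reflX_zero, h0, hp]; push_cast; ring) (by simp [f_one, h1]))

/-- The top and bottom rows are disjoint chains of three cells from left to right. Each dissipates
at least `conductance m / 3`, because its side averages climb from 0 to 1 in three crossings. -/
theorem le_conductance_succ (m : ℕ) : 2 / 3 * conductance m ≤ conductance (m + 1) := by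
  have hc := conductance_pos m
  set u := potential (m + 1)
  have hl : ∀ i, dx i = 0 → average m (u ∘ f i) = 0 := by
    intro i hi
    rw [← average_const m 0]
    exact average_congr m fun p _ hp => (potential_admissible _).1 _ (by simp [f_zero, hi, hp])
  have hr : ∀ i, dx i = 2 → average m ((u ∘ f i) ∘ reflX) = 1 := by
    intro i hi
    rw [← average_const m 1]
    refine average_congr m fun p _ hp => (potential_admissible _).2 _ ?_
    rw [f_zero, reflX_zero, hi, hp]
    norm_num
  have row : ∀ i j k : Fin 8, dx i = 0 → dx j = dx i + 1 → dy j = dy i → dx k = dx j + 1 →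
      dy k = dy j → conductance m ≤
        3 * (energy m (u ∘ f i) + energy m (u ∘ f j) + energy m (u ∘ f k)) := by
    intro i j k h1 h2 h3 h4 h5
    have a1 := sq_average_reflX_sub_le m (u ∘ f i)
    have a2 := sq_average_reflX_sub_le m (u ∘ f j)
    have a3 := sq_average_reflX_sub_le m (u ∘ f k)
    rw [hl i h1, average_comp_f_reflX m u h2 h3] at a1
    rw [average_comp_f_reflX m u h4 h5] at a2
    rw [hr k (by omega)] at a3
    set s := average m (u ∘ f j)
    set t := average m (u ∘ f k)
    have h6 : 1 ≤ 3 * (conductance m)⁻¹ *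
        (energy m (u ∘ f i) + energy m (u ∘ f j) + energy m (u ∘ f k)) := by
      have e1 : (1 : ℝ) ≤ 3 * ((s - 0) ^ 2 + (t - s) ^ 2 + (1 - t) ^ 2) := by
        nlinarith [sq_nonneg (2 * s - t), sq_nonneg (2 * t - s - 1), sq_nonneg (s - (t - s)),
          sq_nonneg ((t - s) - (1 - t)), sq_nonneg (s - (1 - t))]
      linarith
    rw [mul_right_comm, ← div_eq_mul_inv, le_div_iff₀ hc] at h6
    linarith
  have r1 := row 0 1 2 (by decide) (by decide) (by decide) (by decide) (by decide)
  have r2 := row 6 5 4 (by decide) (by decide) (by decide) (by decide) (by decide)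
  have h : conductance (m + 1) = _ := energy_succ m u
  rw [h, Fin.sum_univ_eight]
  have := energy_nonneg m (u ∘ f 3)
  have := energy_nonneg m (u ∘ f 7)
  linarith

/-! ### Resistances between points -/

/-- `r` bounds all the resistances between points of `V_n`. -/
def IsResBound (n : ℕ) (r : ℝ) : Prop := ∀ (u : Plane → ℝ) (w v : W n) (i j : Fin 8),
  (u (fw w (pt i)) - u (fw v (pt j))) ^ 2 ≤ r * energy n u

theorem IsResBound.mono {n : ℕ} {r s : ℝ} (h : IsResBound n r) (hrs : r ≤ s) : IsResBound n s :=
  fun u w v i j => (h u w v i j).trans (mul_le_mul_of_nonneg_right hrs (energy_nonneg _ _))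

theorem isResBound_zero : IsResBound 0 49 := by
  intro u w v i j
  change (u (pt i) - u (pt j)) ^ 2 ≤ _
  have hE := energy_nonneg 0 u
  have h1 : ∀ i, |u (pt i) - u (pt (i + 1))| ≤ √(energy 0 u) := fun i => by
    refine Real.abs_le_sqrt ?_
    rw [energy_zero]
    exact Finset.single_le_sum (f := fun i => (u (pt i) - u (pt (i + 1))) ^ 2)
      (fun _ _ => sq_nonneg _) (Finset.mem_univ i)
  have h2 : ∀ k : ℕ, |u (pt i) - u (pt (i + Fin.ofNat 8 k))| ≤ k * √(energy 0 u) := by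
    intro k
    induction k with
    | zero => simp
    | succ k ih =>
      have e : i + Fin.ofNat 8 (k + 1) = i + Fin.ofNat 8 k + 1 := by
        rw [add_assoc]
        congr 1
        ext
        simp [Fin.val_add]
      rw [e]
      have a1 := h1 (i + Fin.ofNat 8 k)
      have a2 := abs_sub_le (u (pt i)) (u (pt (i + Fin.ofNat 8 k)))
        (u (pt (i + Fin.ofNat 8 k + 1)))
      push_cast
      linarith
  have h3 := h2 (j - i : Fin 8)
  have e : i + Fin.ofNat 8 ((j - i : Fin 8) : ℕ) = j := by simp
  rw [e] at h3
  have h4 : (((j - i : Fin 8) : ℕ) : ℝ) ≤ 7 := by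
    have := (j - i : Fin 8).isLt
    exact_mod_cast Nat.lt_succ_iff.1 this
  have h5 : |u (pt i) - u (pt j)| ≤ 7 * √(energy 0 u) :=
    h3.trans (mul_le_mul_of_nonneg_right h4 (Real.sqrt_nonneg _))
  calc (u (pt i) - u (pt j)) ^ 2 = |u (pt i) - u (pt j)| ^ 2 := (sq_abs _).symm
    _ ≤ (7 * √(energy 0 u)) ^ 2 := pow_le_pow_left₀ (abs_nonneg _) h5 2
    _ = 49 * energy 0 u := by rw [mul_pow, Real.sq_sqrt hE]; norm_num

theorem exists_fw_add {m n : ℕ} (x : W (m + n)) :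
    ∃ (w : W n) (v : W m), ∀ p, fw x p = fw w (fw v p) := by
  induction n with
  | zero => exact ⟨fun k => k.elim0, x, fun p => rfl⟩
  | succ n ih =>
    obtain ⟨w, v, h⟩ := ih (Fin.tail (n := m + n) x)
    refine ⟨Fin.cons (x 0) w, v, fun p => ?_⟩
    rw [fw_cons, ← h]
    rfl

/-- A point differs from the average of its `n`-cell by the resistance bound inside that cell, and
averages of different cells are joined by a chain whose length depends on `n` only. The factor 6 is
3, for a sum of three terms, times the two end points; it does not depend on `n`. -/
theorem exists_isResBound_add (n : ℕ) : ∃ C : ℝ, 0 ≤ C ∧ ∀ m r, 0 ≤ r → IsResBound m r →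
    IsResBound (m + n) (6 * r + C * (conductance m)⁻¹) := by
  obtain ⟨C, hC, h⟩ := exists_chain_const n
  refine ⟨24 * C ^ 2, by positivity, fun m r hr hm u x y i j => ?_⟩
  obtain ⟨w, w', hw⟩ := exists_fw_add x
  obtain ⟨v, v', hv⟩ := exists_fw_add y
  rw [hw, hv]
  have hc := inv_pos.2 (conductance_pos m)
  have hE := energy_nonneg (m + n) u
  have hp : ∀ (w : W n) (w' : W m) i,
      (u (fw w (fw w' (pt i))) - average m (u ∘ fw w)) ^ 2 ≤ r * energy (m + n) u :=
    fun w w' i => sq_sub_average_le m (mul_nonneg hr hE) fun v' j =>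
      (hm (u ∘ fw w) w' v' i j).trans (mul_le_mul_of_nonneg_left (energy_comp_fw_le m u w) hr)
  have hA := h (fun w => average m (u ∘ fw w)) (√(8 * (conductance m)⁻¹ * energy (m + n) u))
    (Real.sqrt_nonneg _) (fun w v hwv => Real.abs_le_sqrt ((sq_average_sideAdj_le m u hwv).trans (by
      have h1 := mul_le_mul_of_nonneg_left (energy_comp_fw_le m u w) hc.le
      have h2 := mul_le_mul_of_nonneg_left (energy_comp_fw_le m u v) hc.le
      linarith))) w v
  have hA' : (average m (u ∘ fw w) - average m (u ∘ fw v)) ^ 2 ≤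
      C ^ 2 * (8 * (conductance m)⁻¹ * energy (m + n) u) := by
    rw [← sq_abs]
    refine (pow_le_pow_left₀ (abs_nonneg _) hA 2).trans_eq ?_
    rw [mul_pow, Real.sq_sqrt (by positivity)]
  have h1 := hp w w' i
  have h2 := hp v v' j
  set a := u (fw w (fw w' (pt i)))
  set b := average m (u ∘ fw w)
  set c := average m (u ∘ fw v)
  set d := u (fw v (fw v' (pt j)))
  have h3 : (a - d) ^ 2 ≤ 3 * ((a - b) ^ 2 + (b - c) ^ 2 + (d - c) ^ 2) := by
    linarith [sq_nonneg ((a - b) - (b - c)), sq_nonneg ((a - b) + (d - c)),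
      sq_nonneg ((b - c) + (d - c))]
  linarith

theorem exists_isResBound (n : ℕ) : ∃ r : ℝ, 0 ≤ r ∧ IsResBound n r := by
  induction n with
  | zero => exact ⟨49, by norm_num, isResBound_zero⟩
  | succ n ih =>
    obtain ⟨r, hr, h⟩ := ih
    obtain ⟨C, hC, hadd⟩ := exists_isResBound_add 1
    have := conductance_pos n
    exact ⟨_, by positivity, hadd n r hr h⟩

theorem exists_isResBound_pow {ρ K : ℝ} (hρ : 1 < ρ) (hK : 0 ≤ K)
    (h : ∀ n, (conductance n)⁻¹ ≤ K * ρ ^ n) : ∃ C : ℝ, 0 < C ∧ ∀ n, IsResBound n (C * ρ ^ n) := by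
  -- A step of length `N` turns `C ρ^m` into at most `(6 + 1) C ρ^m`; any threshold from 7 on would
  -- do.
  obtain ⟨N, hN⟩ := pow_unbounded_of_one_lt 12 hρ
  obtain ⟨D, hD, hadd⟩ := exists_isResBound_add N
  choose r hr0 hr using exists_isResBound
  have hsum : 0 ≤ ∑ k ∈ Finset.range N, r k := Finset.sum_nonneg fun k _ => hr0 k
  set C := ∑ k ∈ Finset.range N, r k + D * K + 1
  have hDK : 0 ≤ D * K := mul_nonneg hD hK
  have hC : 0 < C := by positivity
  have hN0 : N ≠ 0 := by
    rintro rfl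
    norm_num at hN
  refine ⟨C, hC, fun n => ?_⟩
  induction n using Nat.strong_induction_on with
  | _ n ih =>
    have hρn : ∀ k, 1 ≤ ρ ^ k := fun k => one_le_pow₀ hρ.le
    obtain hn | hn := lt_or_ge n N
    · refine (hr n).mono ?_
      have h1 : r n ≤ ∑ k ∈ Finset.range N, r k :=
        Finset.single_le_sum (fun k _ => hr0 k) (Finset.mem_range.2 hn)
      have h2 := hρn n
      nlinarith
    · obtain ⟨m, rfl⟩ := Nat.exists_eq_add_of_le' hn
      have hpos : 0 < ρ ^ m := by positivity
      refine (hadd m _ (by positivity) (ih m (by omega))).mono ?_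
      have h1 : D * (conductance m)⁻¹ ≤ D * K * ρ ^ m := by
        rw [mul_assoc]
        exact mul_le_mul_of_nonneg_left (h m) hD
      have h2 : D * K ≤ C := by linarith
      have h3 := mul_le_mul_of_nonneg_right h2 hpos.le
      rw [pow_add]
      have h4 := mul_le_mul_of_nonneg_left hN.le (mul_pos hC hpos).le
      linarith [mul_pos hC hpos]

/-! ### The growth rate -/

/-- Both `log A + log a_n` and `log B - log a_n` are subadditive, and their Fekete limits are
opposite. As the limit is the infimum of the quotients, each sequence is at least `n` times its
limit, which gives the two bounds with no error term. -/
theorem exists_growth_rate {a : ℕ → ℝ} (ha : ∀ n, 0 < a n) {A B : ℝ} (hA : 0 < A) (hB : 0 < B)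
    (h1 : ∀ m n, a (m + n) ≤ A * a m * a n) (h2 : ∀ m n, a n * a m ≤ B * a (m + n))
    (h3 : ∀ n, a (n + 1) ≤ 6 / 7 * a n) (h4 : ∀ n, 2 / 3 * a n ≤ a (n + 1)) :
    ∃ ρ ∈ Set.Icc (7 / 6 : ℝ) (3 / 2), ∀ n, A⁻¹ ≤ a n * ρ ^ n ∧ a n * ρ ^ n ≤ B := by
  let u : ℕ → ℝ := fun n => Real.log A + Real.log (a n)
  let v : ℕ → ℝ := fun n => Real.log B - Real.log (a n)
  have hu : Subadditive u := by
    intro m n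
    have := Real.log_le_log (ha _) (h1 m n)
    rw [Real.log_mul (mul_pos hA (ha m)).ne' (ha n).ne', Real.log_mul hA.ne' (ha m).ne'] at this
    simp only [u]
    linarith
  have hv : Subadditive v := by
    intro m n
    have := Real.log_le_log (mul_pos (ha n) (ha m)) (h2 m n)
    rw [Real.log_mul (ha n).ne' (ha m).ne', Real.log_mul hB.ne' (ha _).ne'] at this
    simp only [v]
    linarith
  have hup : ∀ n : ℕ, Real.log (a n) ≤ Real.log (a 0) + n * Real.log (6 / 7) := by
    intro n
    induction n with
    | zero => simp
    | succ n ih =>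
      have := Real.log_le_log (ha _) (h3 n)
      rw [Real.log_mul (by norm_num) (ha n).ne'] at this
      push_cast
      linarith
  have hlow : ∀ n : ℕ, Real.log (a 0) + n * Real.log (2 / 3) ≤ Real.log (a n) := by
    intro n
    induction n with
    | zero => simp
    | succ n ih =>
      have := Real.log_le_log (mul_pos (by norm_num) (ha n)) (h4 n)
      rw [Real.log_mul (by norm_num) (ha n).ne'] at this
      push_cast
      linarith
  have hlim : ∀ c d : ℝ, Filter.Tendsto (fun n : ℕ => (c + n * d) / n) Filter.atTop (nhds d) := by
    intro c d
    have := (tendsto_const_div_atTop_nhds_zero_nat c).add_const d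
    rw [zero_add] at this
    refine this.congr' ?_
    filter_upwards [Filter.eventually_gt_atTop 0] with n hn
    have : (n : ℝ) ≠ 0 := by positivity
    field_simp
  have hbdd : ∀ {s : ℕ → ℝ} {c d : ℝ}, (∀ n : ℕ, c + n * d ≤ s n) →
      BddBelow (Set.range fun n => s n / n) := by
    intro s c d hs
    obtain ⟨b, hb⟩ := (hlim c d).bddBelow_range
    refine ⟨b, ?_⟩
    rintro _ ⟨n, rfl⟩
    exact (hb ⟨n, rfl⟩).trans (div_le_div_of_nonneg_right (hs n) (Nat.cast_nonneg n))
  have hbu : BddBelow (Set.range fun n => u n / n) :=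
    hbdd (c := Real.log A + Real.log (a 0)) (d := Real.log (2 / 3)) fun n => by
      have := hlow n
      simp only [u]
      linarith
  have hbv : BddBelow (Set.range fun n => v n / n) :=
    hbdd (c := Real.log B - Real.log (a 0)) (d := -Real.log (6 / 7)) fun n => by
      have := hup n
      simp only [v]
      linarith
  have tu := hu.tendsto_lim hbu
  have tv := hv.tendsto_lim hbv
  have hsum : hu.lim + hv.lim = 0 := by
    have t0 := tendsto_const_div_atTop_nhds_zero_nat (Real.log A + Real.log B)
    refine tendsto_nhds_unique ((tu.add tv).congr fun n => ?_) t0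
    simp only [u, v]
    ring
  have hL1 : hu.lim ≤ Real.log (6 / 7) := by
    refine le_of_tendsto_of_tendsto' tu (hlim (Real.log A + Real.log (a 0)) _) fun n => ?_
    refine div_le_div_of_nonneg_right ?_ (Nat.cast_nonneg n)
    have := hup n
    simp only [u]
    linarith
  have hL2 : Real.log (2 / 3) ≤ hu.lim := by
    refine le_of_tendsto_of_tendsto' (hlim (Real.log A + Real.log (a 0)) _) tu fun n => ?_
    refine div_le_div_of_nonneg_right ?_ (Nat.cast_nonneg n)
    have := hlow n
    simp only [u]
    linarith
  have key : ∀ {s : ℕ → ℝ} (hs : Subadditive s), BddBelow (Set.range fun n => s n / n) →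
      ∀ n : ℕ, n * hs.lim ≤ s n := by
    intro s hs hb n
    obtain rfl | hn := Nat.eq_zero_or_pos n
    · have := hs 0 0
      simp only [add_zero] at this
      simp only [Nat.cast_zero, zero_mul]
      linarith
    · have := hs.lim_le_div hb hn.ne'
      rwa [le_div_iff₀ (by positivity), mul_comm] at this
  have e1 : Real.log (7 / 6) = -Real.log (6 / 7) := by
    rw [← Real.log_inv]; norm_num
  have e2 : Real.log (3 / 2) = -Real.log (2 / 3) := by
    rw [← Real.log_inv]; norm_num
  refine ⟨Real.exp (-hu.lim), ⟨?_, ?_⟩, fun n => ⟨?_, ?_⟩⟩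
  · rw [← Real.log_le_iff_le_exp (by norm_num), e1]
    linarith
  · rw [← Real.le_log_iff_exp_le (by norm_num), e2]
    linarith
  · have := key hu hbu n
    simp only [u] at this
    rw [← Real.exp_log (ha n), ← Real.exp_nat_mul, ← Real.exp_add, ← Real.exp_log hA,
      ← Real.exp_neg, Real.exp_le_exp]
    linarith
  · have := key hv hbv n
    simp only [v] at this
    rw [← Real.exp_log (ha n), ← Real.exp_nat_mul, ← Real.exp_add, ← Real.le_log_iff_exp_le hB]
    have e : hv.lim = -hu.lim := by linarith
    rw [e] at this
    linarith

theorem exists_conductance_rate : ∃ ρ ∈ Set.Icc (7 / 6 : ℝ) (3 / 2), ∀ n,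
    (60 : ℝ)⁻¹ ≤ conductance n * ρ ^ n ∧ conductance n * ρ ^ n ≤ 9216 :=
  exists_growth_rate conductance_pos (by norm_num) (by norm_num) conductance_add_le
    conductance_mul_le conductance_succ_le le_conductance_succ

/-! ### The energies on points and effective resistances -/

theorem mem_V {n : ℕ} {p : Plane} : p ∈ V n ↔ ∃ (w : W n) (i : Fin 8), fw w (pt i) = p := by
  classical
  induction n generalizing p with
  | zero =>
    simp only [V, Finset.mem_image, Finset.mem_univ, true_and]
    exact ⟨fun ⟨i, hi⟩ => ⟨fun k => k.elim0, i, hi⟩, fun ⟨_, i, hi⟩ => ⟨i, hi⟩⟩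
  | succ n ih =>
    simp only [V, Finset.mem_biUnion, Finset.mem_univ, true_and, Finset.mem_image, ih]
    constructor
    · rintro ⟨i, _, ⟨w, j, rfl⟩, rfl⟩
      exact ⟨Fin.cons i w, j, fw_cons i w _⟩
    · rintro ⟨w, j, rfl⟩
      exact ⟨w 0, _, ⟨Fin.tail w, j, rfl⟩, rfl⟩

theorem dist_fw {n : ℕ} (w : W n) (p q : Plane) :
    dist (fw w p) (fw w q) = (3⁻¹) ^ n * dist p q := by
  induction n with
  | zero => simp [fw]
  | succ n ih =>
    simp only [fw, Function.comp]
    rw [dist_f, ih, pow_succ]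
    ring

theorem dist_pt_eq_iff (i j : Fin 8) : dist (pt i) (pt j) = 2⁻¹ ↔ j = i + 1 ∨ i = j + 1 := by
  have h2 : (dx i - dx j) ^ 2 + (dy i - dy j) ^ 2 = 1 ↔ j = i + 1 ∨ i = j + 1 := by
    revert i j; decide
  have h1 : dist (pt i) (pt j) ^ 2 = ((dx i - dx j) ^ 2 + (dy i - dy j) ^ 2 : ℤ) / 4 := by
    rw [EuclideanSpace.dist_eq, Real.sq_sqrt (by positivity), Fin.sum_univ_two, Real.dist_eq,
      Real.dist_eq, sq_abs, sq_abs, pt_zero, pt_zero, pt_one, pt_one]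
    push_cast
    ring
  rw [← h2, ← pow_left_inj₀ dist_nonneg (by norm_num) two_ne_zero, h1]
  constructor
  · intro h
    have : (((dx i - dx j) ^ 2 + (dy i - dy j) ^ 2 : ℤ) : ℝ) = 1 := by
      linarith
    exact_mod_cast this
  · intro h
    rw [h]
    norm_num

/-- In a cell, the pairs at distance `2⁻¹ * 3⁻ⁿ` are exactly the 8 consecutive pairs on its
boundary; each occurs in both orders, which the factor `1 / 2` corrects. -/
theorem energyV_eq (n : ℕ) (g : Plane → ℝ) : energyV n (fun p => g p) = energy n g := by
  classical
  rw [energyV, energy_eq_sum]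
  refine Finset.sum_congr rfl fun w _ => ?_
  let φ : Fin 8 → V n := fun i => ⟨fw w (pt i), mem_V.2 ⟨w, i, rfl⟩⟩
  have hinj : Function.Injective φ := by
    intro i j hij
    obtain ⟨h0, h1⟩ := add_eq_of_fw_eq_fw (Subtype.ext_iff.1 hij)
    rw [add_left_inj, pt_zero, pt_zero, div_left_inj' two_ne_zero] at h0
    rw [add_left_inj, pt_one, pt_one, div_left_inj' two_ne_zero] at h1
    exact letter_ext (Int.cast_injective (α := ℝ) h0) (Int.cast_injective (α := ℝ) h1)
  have hVw : ∀ p : V n, (p : Plane) ∈ Vw w → p ∈ Set.range φ := by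
    rintro ⟨p, hp⟩ ⟨q, hq, rfl⟩
    obtain ⟨i, rfl⟩ : ∃ i, pt i = q := by simpa [V] using hq
    exact ⟨i, rfl⟩
  have hVw' : ∀ i, fw w (pt i) ∈ Vw w := fun i => ⟨pt i, pt_mem_V 0 i, rfl⟩
  have h3 : ((3 : ℝ)⁻¹) ^ n ≠ 0 := by positivity
  have hd : ∀ i j, dist (fw w (pt i)) (fw w (pt j)) = 2⁻¹ * (3⁻¹) ^ n ↔
      j = i + 1 ∨ i = j + 1 := by
    intro i j
    rw [dist_fw, mul_comm, mul_left_inj' h3, dist_pt_eq_iff]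
  rw [← Fintype.sum_of_injective φ hinj (fun i => ∑ j, if j = i + 1 ∨ i = j + 1 then
    (g (fw w (pt i)) - g (fw w (pt j))) ^ 2 else 0)]
  · have hsplit : ∀ i j : Fin 8, (if j = i + 1 ∨ i = j + 1 then
        (g (fw w (pt i)) - g (fw w (pt j))) ^ 2 else 0) =
        (if j = i + 1 then (g (fw w (pt i)) - g (fw w (pt j))) ^ 2 else 0) +
        (if i = j + 1 then (g (fw w (pt i)) - g (fw w (pt j))) ^ 2 else 0) := by
      intro i j
      have : ¬(j = i + 1 ∧ i = j + 1) := by revert i j; decide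
      by_cases a : j = i + 1 <;> by_cases b : i = j + 1
      · exact absurd ⟨a, b⟩ this
      · rw [if_pos (Or.inl a), if_pos a, if_neg b, add_zero]
      · rw [if_pos (Or.inr b), if_neg a, if_pos b, zero_add]
      · rw [if_neg (not_or.2 ⟨a, b⟩), if_neg a, if_neg b, add_zero]
    simp only [hsplit, Finset.sum_add_distrib]
    rw [Finset.sum_comm (f := fun i j : Fin 8 =>
      if i = j + 1 then (g (fw w (pt i)) - g (fw w (pt j))) ^ 2 else 0)]
    simp only [Finset.sum_ite_eq', Finset.mem_univ, if_true]
    rw [energy_zero, ← Finset.sum_add_distrib, Finset.mul_sum]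
    refine Finset.sum_congr rfl fun i _ => ?_
    simp only [Function.comp]
    ring
  · intro p hp
    refine Finset.sum_eq_zero fun q _ => if_neg ?_
    rintro ⟨h, -⟩
    exact hp (hVw p h)
  · intro i
    refine Fintype.sum_of_injective φ hinj _ _ ?_ fun j => ?_
    · intro q hq
      refine if_neg ?_
      rintro ⟨-, h, -⟩
      exact hq (hVw q h)
    · simp only [φ, hVw', true_and, hd]

theorem exists_eq_restrict {n : ℕ} (u : V n → ℝ) (g : Plane → ℝ) :
    ∃ g' : Plane → ℝ, (u = fun p : V n => g' p) ∧ ∀ p ∉ V n, g' p = g p := by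
  classical
  refine ⟨fun p => if h : p ∈ V n then u ⟨p, h⟩ else g p, ?_, fun p hp => by simp [hp]⟩
  funext p
  simp

theorem ofReal_le_effRes {X : Type} {D : (X → ℝ) → ℝ} {A B : Set X} {u : X → ℝ}
    (hA : ∀ x ∈ A, u x = 0) (hB : ∀ x ∈ B, u x = 1) {r : ℝ} (hr : 0 < r) (h : D u * r ≤ 1) :
    ENNReal.ofReal r ≤ effRes D A B := by
  rw [effRes, ENNReal.le_inv_iff_le_inv, ← ENNReal.ofReal_inv_of_pos hr]
  refine iInf₂_le_of_le u ⟨hA, hB⟩ (ENNReal.ofReal_le_ofReal ?_)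
  rwa [← one_div, le_div_iff₀ hr]

theorem effRes_le_ofReal {X : Type} {D : (X → ℝ) → ℝ} {A B : Set X} {r : ℝ} (hr : 0 < r)
    (h : ∀ u : X → ℝ, (∀ x ∈ A, u x = 0) → (∀ x ∈ B, u x = 1) → 1 ≤ r * D u) :
    effRes D A B ≤ ENNReal.ofReal r := by
  rw [effRes, ENNReal.inv_le_iff_inv_le, ← ENNReal.ofReal_inv_of_pos hr]
  refine le_iInf₂ fun u hu => ENNReal.ofReal_le_ofReal ?_
  rw [← one_div, div_le_iff₀' hr]
  exact h u hu.1 hu.2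

/-- The reflections used reverse the orientation of boundary edges, so the end points arrive
exchanged; passing to `1 - u` exchanges the boundary values back. -/
theorem effRes_singleton_le {X : Type} {D : (X → ℝ) → ℝ} {x y x' y' : X} (e : X → X)
    (hD : ∀ u, D (fun z => 1 - u (e z)) ≤ D u) (hx : e x' = y) (hy : e y' = x) :
    effRes D {x} {y} ≤ effRes D {x'} {y'} := by
  rw [effRes, effRes, ENNReal.inv_le_inv]
  refine le_iInf₂ fun u hu => ?_
  have h0 : u x = 0 := hu.1 x rfl
  have h1 : u y = 1 := hu.2 y rfl
  refine iInf₂_le_of_le (fun z => 1 - u (e z)) ⟨?_, ?_⟩ (ENNReal.ofReal_le_ofReal (hD u))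
  · rintro _ rfl
    simp [hx, h1]
  · rintro _ rfl
    simp [hy, h0]

/-! ### Equality of the resistances between consecutive points and words -/

/-- The two reflections act on edge indices by `k ↦ 1 - k` and `k ↦ -1 - k`, and alternating them
visits all eight. As they are involutions, inequalities are enough. -/
theorem eq_of_dihedral {α : Type*} [PartialOrder α] {r : Fin 8 → α} (h1 : ∀ k, r k ≤ r (1 - k))
    (h2 : ∀ k, r k ≤ r (-1 - k)) (i j : Fin 8) : r i = r j := by
  have e1 : ∀ k, r k = r (1 - k) := fun k => le_antisymm (h1 k) (by simpa using h1 (1 - k))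
  have e2 : ∀ k, r k = r (-1 - k) := fun k => le_antisymm (h2 k) (by simpa using h2 (-1 - k))
  have a1 : r 0 = r 1 := e1 0
  have a2 : r 1 = r 6 := e2 1
  have a3 : r 6 = r 3 := e1 6
  have a4 : r 3 = r 4 := e2 3
  have a5 : r 4 = r 5 := e1 4
  have a6 : r 5 = r 2 := e2 5
  have a7 : r 2 = r 7 := e1 2
  have key : ∀ k, r k = r 0 := by
    intro k
    fin_cases k <;> simp [a1, a2, a3, a4, a5, a6, a7]
  rw [key i, key j]

theorem map_mem_V {n : ℕ} {e : Plane → Plane} {s : Fin 8 → Fin 8}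
    (hpt : ∀ i, e (pt i) = pt (s i)) (hf : ∀ i p, f (s i) (e p) = e (f i p)) {p : Plane}
    (hp : p ∈ V n) : e p ∈ V n := by
  obtain ⟨w, i, rfl⟩ := mem_V.1 hp
  refine mem_V.2 ⟨fun k => s (w k), s i, ?_⟩
  clear hp
  induction n with
  | zero => exact (hpt i).symm
  | succ n ih =>
    change f (s (w 0)) (fw (fun k => s (Fin.tail w k)) (pt (s i))) = e (f (w 0) _)
    rw [ih, hf]

theorem energyV_one_sub_comp {n : ℕ} {e : Plane → Plane} {s : Fin 8 → Fin 8}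
    (hpt : ∀ i, e (pt i) = pt (s i)) (hf : ∀ i p, f (s i) (e p) = e (f i p))
    (hE : ∀ u, energy n (u ∘ e) = energy n u) (u : V n → ℝ) :
    energyV n (fun p => 1 - u ⟨e p, map_mem_V hpt hf p.2⟩) ≤ energyV n u := by
  obtain ⟨g, rfl, -⟩ := exists_eq_restrict u fun _ => 0
  have h := energyV_eq n fun p => 1 + -1 * (g ∘ e) p
  rw [energy_affine, hE] at h
  rw [energyV_eq]
  refine le_of_eq ?_
  rw [← one_mul (energy n g), show (1 : ℝ) = (-1) ^ 2 by norm_num, ← h]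
  congr 1
  funext p
  simp
  ring

theorem resV_adjacent_eq (n : ℕ) (i j : Fin 8) :
    resV n (ptV n i) (ptV n (i + 1)) = resV n (ptV n j) (ptV n (j + 1)) := by
  refine eq_of_dihedral (r := fun i => resV n (ptV n i) (ptV n (i + 1))) (fun k => ?_)
    (fun k => ?_) i j
  · refine effRes_singleton_le _ (energyV_one_sub_comp reflX_pt f_reflX (energy_comp_reflX n))
      (Subtype.ext ?_) (Subtype.ext ?_)
    · change reflX (pt (1 - k)) = pt (k + 1)
      rw [reflX_pt]
      congr 1
      revert k; decide
    · change reflX (pt (1 - k + 1)) = pt k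
      rw [reflX_pt]
      congr 1
      revert k; decide
  · refine effRes_singleton_le _ (energyV_one_sub_comp swap_pt f_swap (energy_comp_swap n))
      (Subtype.ext ?_) (Subtype.ext ?_)
    · change swap (pt (-1 - k)) = pt (k + 1)
      rw [swap_pt]
      congr 1
      revert k; decide
    · change swap (pt (-1 - k + 1)) = pt k
      rw [swap_pt]
      congr 1
      revert k; decide

open Classical in
theorem energyW_eq (n : ℕ) (U : W n → ℝ) :
    energyW n U = (1 / 2) * ∑ w, ∑ v, if SideAdj w v then (U w - U v) ^ 2 else 0 := by
  rw [energyW]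
  congr 1
  refine Finset.sum_congr rfl fun w _ => Finset.sum_congr rfl fun v _ => ?_
  -- On the diagonal the summand is 0, so the dimension of a cell itself plays no role.
  by_cases h : w = v
  · simp [h]
  · have : AdjW w v ↔ SideAdj w v := ⟨fun k => k.sideAdj h, SideAdj.adjW⟩
    simp only [this]

theorem energyW_one_sub_comp {n : ℕ} (e : W n ≃ W n)
    (he : ∀ w v, SideAdj (e w) (e v) ↔ SideAdj w v) (U : W n → ℝ) :
    energyW n (fun w => 1 - U (e w)) ≤ energyW n U := by
  classical
  refine le_of_eq ?_
  rw [energyW_eq, energyW_eq]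
  congr 1
  conv_rhs => rw [← e.sum_comp]
  refine Finset.sum_congr rfl fun w _ => ?_
  conv_rhs => rw [← e.sum_comp]
  refine Finset.sum_congr rfl fun v _ => ?_
  simp only [he]
  congr 1
  ring

theorem zx_reflect {n : ℕ} (w : W n) :
    zx (fun k => 2 - w k) = ∑ k : Fin n, 3 ^ (k.rev : ℕ) * 2 - zx w := by
  rw [zx, zx, ← Finset.sum_sub_distrib]
  refine Finset.sum_congr rfl fun k _ => ?_
  have : ∀ i : Fin 8, dx (2 - i) = 2 - dx i := by decide
  rw [this]
  ring

theorem zy_reflect {n : ℕ} (w : W n) : zy (fun k => 2 - w k) = zy w := by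
  have : ∀ i : Fin 8, dy (2 - i) = dy i := by decide
  simp only [zy, this]

theorem zx_neg {n : ℕ} (w : W n) : zx (fun k => -w k) = zy w := by
  have : ∀ i : Fin 8, dx (-i) = dy i := by decide
  simp only [zx, zy, this]

theorem zy_neg {n : ℕ} (w : W n) : zy (fun k => -w k) = zx w := by
  have : ∀ i : Fin 8, dy (-i) = dx i := by decide
  simp only [zx, zy, this]

theorem resW_adjacent_eq (n : ℕ) (i j : Fin 8) :
    resW n (constWord n i) (constWord n (i + 1)) = resW n (constWord n j) (constWord n (j + 1)) := by
  refine eq_of_dihedral (r := fun i => resW n (constWord n i) (constWord n (i + 1))) (fun k => ?_)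
    (fun k => ?_) i j
  · refine effRes_singleton_le _ (energyW_one_sub_comp
      (Equiv.arrowCongr (Equiv.refl _) (Equiv.subLeft 2)) fun w v => ?_) ?_ ?_
    · change SideAdj (fun k => 2 - w k) (fun k => 2 - v k) ↔ _
      unfold SideAdj
      rw [zx_reflect, zx_reflect, zy_reflect, zy_reflect]
      omega
    · funext x
      change 2 - (1 - k) = k + 1
      revert k; decide
    · funext x
      change 2 - (1 - k + 1) = k
      revert k; decide
  · refine effRes_singleton_le _ (energyW_one_sub_comp
      (Equiv.arrowCongr (Equiv.refl _) (Equiv.neg _)) fun w v => ?_) ?_ ?_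
    · change SideAdj (fun k => -w k) (fun k => -v k) ↔ _
      unfold SideAdj
      rw [zx_neg, zx_neg, zy_neg, zy_neg]
      omega
    · funext x
      change -(-1 - k) = k + 1
      revert k; decide
    · funext x
      change -(-1 - k + 1) = k
      revert k; decide

/-! ### Comparison of the cell graph with the point graph -/

theorem energyW_le {n : ℕ} {e U : W n → ℝ} (he : ∀ w, 0 ≤ e w)
    (hU : ∀ w v, SideAdj w v → (U w - U v) ^ 2 ≤ e w + e v) :
    energyW n U ≤ 9 * ∑ w, e w := by
  classical
  have h : ∑ w, ∑ v, (if SideAdj w v then (U w - U v) ^ 2 else 0) ≤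
      ∑ w, nearSum e w + ∑ w, nearSum e w := by
    simp only [nearSum]
    conv_rhs =>
      arg 2
      rw [Finset.sum_comm]
    rw [← Finset.sum_add_distrib]
    refine Finset.sum_le_sum fun w _ => ?_
    rw [← Finset.sum_add_distrib]
    refine Finset.sum_le_sum fun v _ => ?_
    by_cases hs : SideAdj w v
    · simp only [hs, hs.near, hs.near.symm, if_true]
      linarith [hU w v hs]
    · simp only [hs, if_false]
      have := he w
      have := he v
      split_ifs <;> linarith
  have := sum_nearSum_le he
  rw [energyW_eq]
  linarith

/-- `U` is spread to the vertices with at most `2304 * 2` times its energy, and the bound for points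
is used there. Returning to words at both ends costs `8 * 2` times the energy each; the factor 3 for
three terms gives 96 and 13824. -/
theorem sq_sub_le_energyW {n : ℕ} {r : ℝ} (hr : IsResBound n r) (hr0 : 0 ≤ r) (U : W n → ℝ)
    (w v : W n) : (U w - U v) ^ 2 ≤ (96 + 13824 * r) * energyW n U := by
  classical
  let G : W n → ℝ := fun w => ∑ v, if SideAdj w v then (U w - U v) ^ 2 else 0
  have hG : ∀ w, 0 ≤ G w := fun w => Finset.sum_nonneg fun v _ => by
    split_ifs <;> positivity
  have hsum : ∑ w, G w = 2 * energyW n U := by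
    rw [energyW_eq]
    ring
  have hU : ∀ w v, SideAdj w v → (U w - U v) ^ 2 ≤ G w + G v := by
    intro w v h
    have h1 : (if SideAdj w v then (U w - U v) ^ 2 else 0) ≤ G w :=
      Finset.single_le_sum (f := fun v => if SideAdj w v then (U w - U v) ^ 2 else 0)
        (fun v _ => by split_ifs <;> positivity) (Finset.mem_univ v)
    rw [if_pos h] at h1
    linarith [hG v]
  obtain ⟨g, hg⟩ := exists_extension U
  have hnear : ∀ w, nearSum G w ≤ 2 * energyW n U := by
    intro w
    rw [← hsum, nearSum]
    refine Finset.sum_le_sum fun v _ => ?_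
    split_ifs
    · exact le_rfl
    · exact hG v
  have hb : ∀ w i, (g (fw w (pt i)) - U w) ^ 2 ≤ 8 * nearSum G w := by
    intro w i
    obtain ⟨v, hv, hgv⟩ := hg w i
    rw [hgv]
    exact sq_sub_le_nearSum hG hU hv
  have hE := energy_le_of_near hG hb
  rw [hsum] at hE
  have h1 := hb w 0
  have h2 := hb v 0
  have h3 := hr g w v 0 0
  have h4 := hnear w
  have h5 := hnear v
  have h6 := mul_le_mul_of_nonneg_left hE hr0
  set a := g (fw w (pt 0))
  set b := g (fw v (pt 0))
  have h7 : (U w - U v) ^ 2 ≤ 3 * ((a - U w) ^ 2 + (a - b) ^ 2 + (b - U v) ^ 2) := by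
    linarith [sq_nonneg ((U w - a) - (a - b)), sq_nonneg ((U w - a) - (b - U v)),
      sq_nonneg ((a - b) - (b - U v))]
  linarith

theorem fw_constWord_pt (n : ℕ) (i : Fin 8) : fw (constWord n i) (pt i) = pt i := by
  induction n with
  | zero => rfl
  | succ n ih =>
    change f i (fw (constWord n i) (pt i)) = pt i
    rw [ih, f_pt]

/-- The separating function is sampled at the lower left corner of each cell. Corners of side
neighbours are two edges of one cell apart, and `9 * 16 * 3840 = 552960`. -/
theorem exists_separating_words (m : ℕ) : ∃ U : W (m + 1) → ℝ, U (constWord (m + 1) 0) = 0 ∧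
    U (constWord (m + 1) 1) = 1 ∧ energyW (m + 1) U ≤ 552960 * conductance m := by
  obtain ⟨u, h0, h1, hE⟩ := exists_separating m
  let e : W (m + 1) → ℝ := fun w => 16 * energy 0 (u ∘ fw w)
  have he : ∀ w, 0 ≤ e w := fun w => mul_nonneg (by norm_num) (energy_nonneg _ _)
  refine ⟨fun w => u (fw w (pt 0)), ?_, ?_, ?_⟩
  · change u (fw (constWord (m + 1) 0) (pt 0)) = 0
    rw [fw_constWord_pt, h0]
  · exact h1 _ (fw_mem_sq (constWord m 1) (pt_mem_sq 0))
  · have key : ∀ w : W (m + 1), (u (fw w (pt 0)) - u (fw w (pt 2))) ^ 2 ≤ e w ∧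
        (u (fw w (pt 0)) - u (fw w (pt 6))) ^ 2 ≤ e w := by
      intro w
      simp only [e]
      rw [energy_zero, Fin.sum_univ_eight]
      simp only [Function.comp, Fin.reduceAdd]
      have k : ∀ a b c : ℝ, (a - c) ^ 2 ≤ 2 * ((a - b) ^ 2 + (b - c) ^ 2) := fun a b c => by
        linarith [sq_nonneg ((a - b) - (b - c))]
      have h1 := k (u (fw w (pt 0))) (u (fw w (pt 1))) (u (fw w (pt 2)))
      have h2 := k (u (fw w (pt 6))) (u (fw w (pt 7))) (u (fw w (pt 0)))
      have := sq_nonneg (u (fw w (pt 0)) - u (fw w (pt 1)))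
      have := sq_nonneg (u (fw w (pt 1)) - u (fw w (pt 2)))
      have := sq_nonneg (u (fw w (pt 2)) - u (fw w (pt 3)))
      have := sq_nonneg (u (fw w (pt 3)) - u (fw w (pt 4)))
      have := sq_nonneg (u (fw w (pt 4)) - u (fw w (pt 5)))
      have := sq_nonneg (u (fw w (pt 5)) - u (fw w (pt 6)))
      have := sq_nonneg (u (fw w (pt 6)) - u (fw w (pt 7)))
      have := sq_nonneg (u (fw w (pt 7)) - u (fw w (pt 0)))
      constructor <;> linarith
    have hx : ∀ w v : W (m + 1), zy v = zy w → zx v = zx w + 1 →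
        (u (fw w (pt 0)) - u (fw v (pt 0))) ^ 2 ≤ e w := by
      intro w v e1 e0
      have : fw v (pt 0) = fw w (pt 2) := fw_eq_fw (by simp [pt_zero, e0, add_comm])
        (by simp [pt_one, e1])
      rw [this]
      exact (key w).1
    have hy : ∀ w v : W (m + 1), zx v = zx w → zy v = zy w + 1 →
        (u (fw w (pt 0)) - u (fw v (pt 0))) ^ 2 ≤ e w := by
      intro w v e1 e0
      have : fw v (pt 0) = fw w (pt 6) := fw_eq_fw (by simp [pt_zero, e1])
        (by simp [pt_one, e0, add_comm])
      rw [this]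
      exact (key w).2
    refine (energyW_le he fun w v h => ?_).trans ?_
    · have hw := he w
      have hv := he v
      obtain ⟨e, e' | e'⟩ | ⟨e, e' | e'⟩ := h
      · linarith [hy w v e e']
      · linarith [hy v w e.symm e']
      · linarith [hx w v e e']
      · linarith [hx v w e.symm e']
    · simp only [e]
      rw [← Finset.mul_sum, ← energy_eq_sum]
      linarith

/-! ### Bounds for the resistances -/

theorem ofReal_le_resLR {n : ℕ} {r : ℝ} (hr : 0 < r) (h : conductance n * r ≤ 1) :
    ENNReal.ofReal r ≤ resLR n := by
  rw [resLR]
  refine ofReal_le_effRes (u := fun p : V n => potential n p)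
    (fun p hp => (potential_admissible n).1 p hp.1) (fun p hp => (potential_admissible n).2 p hp.1)
    hr ?_
  rwa [energyV_eq]

theorem resLR_le_ofReal {n : ℕ} {r : ℝ} (hr : 0 < r) (h : 1 ≤ r * conductance n) :
    resLR n ≤ ENNReal.ofReal r := by
  refine effRes_le_ofReal hr fun u h0 h1 => ?_
  -- Off `V n` the default has the boundary values required on the whole lines `x = 0` and `x = 1`.
  obtain ⟨g, rfl, hg⟩ := exists_eq_restrict u fun p => if p 0 = 1 then 1 else 0
  have hV : ∀ p ∈ V n, p 1 ∈ Set.Icc (0 : ℝ) 1 := fun p hp => by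
    obtain ⟨w, i, rfl⟩ := mem_V.1 hp
    exact (fw_mem_sq w (pt_mem_sq i)).2
  have hadm : g ∈ admissible := by
    constructor
    · intro p hp
      by_cases hpV : p ∈ V n
      · exact h0 ⟨p, hpV⟩ ⟨hp, hV p hpV⟩
      · rw [hg p hpV]
        simp [hp]
    · intro p hp
      by_cases hpV : p ∈ V n
      · exact h1 ⟨p, hpV⟩ ⟨hp, hV p hpV⟩
      · rw [hg p hpV]
        simp [hp]
  rw [energyV_eq]
  exact h.trans (mul_le_mul_of_nonneg_left (conductance_le n hadm) hr.le)

theorem resV_le_ofReal {n : ℕ} {r : ℝ} (hr : 0 < r) (h : IsResBound n r) (p q : V n) :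
    resV n p q ≤ ENNReal.ofReal r := by
  refine effRes_le_ofReal hr fun u h0 h1 => ?_
  obtain ⟨g, rfl, -⟩ := exists_eq_restrict u fun _ => 0
  obtain ⟨w, i, hw⟩ := mem_V.1 p.2
  obtain ⟨v, j, hv⟩ := mem_V.1 q.2
  have h2 := h g w v i j
  have e0 : g p = 0 := h0 p rfl
  have e1 : g q = 1 := h1 q rfl
  rw [hw, hv, e0, e1] at h2
  rw [energyV_eq]
  linarith

theorem resW_le_ofReal {n : ℕ} {r : ℝ} (hr : 0 < r) (h : IsResBound n r) (w v : W n) :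
    resW n w v ≤ ENNReal.ofReal (96 + 13824 * r) := by
  refine effRes_le_ofReal (by positivity) fun U h0 h1 => ?_
  have h2 := sq_sub_le_energyW h hr.le U w v
  rw [h0 w rfl, h1 v rfl] at h2
  linarith

theorem ofReal_le_resV_adjacent {m : ℕ} {r : ℝ} (hr : 0 < r) (h : 3840 * conductance m * r ≤ 1)
    (i : Fin 8) : ENNReal.ofReal r ≤ resV (m + 1) (ptV (m + 1) i) (ptV (m + 1) (i + 1)) := by
  rw [resV_adjacent_eq (m + 1) i 0]
  obtain ⟨u, h0, h1, hE⟩ := exists_separating m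
  rw [resV]
  refine ofReal_le_effRes (u := fun p : V (m + 1) => u p) ?_ ?_ hr ?_
  · rintro _ rfl
    exact h0
  · rintro _ rfl
    have := h1 (pt 1) (pt_mem_sq 1)
    rwa [f_pt] at this
  · rw [energyV_eq]
    exact (mul_le_mul_of_nonneg_right hE hr.le).trans h

theorem ofReal_le_resW_adjacent {m : ℕ} {r : ℝ} (hr : 0 < r) (h : 552960 * conductance m * r ≤ 1)
    (i : Fin 8) :
    ENNReal.ofReal r ≤ resW (m + 1) (constWord (m + 1) i) (constWord (m + 1) (i + 1)) := by
  rw [resW_adjacent_eq (m + 1) i 0]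
  obtain ⟨U, h0, h1, hE⟩ := exists_separating_words m
  refine ofReal_le_effRes (u := U) ?_ ?_ hr ((mul_le_mul_of_nonneg_right hE hr.le).trans h)
  · rintro _ rfl
    exact h0
  · rintro _ rfl
    exact h1

end SC

theorem mainTheorem12 :
    ∃ ρ : ℝ, ρ ∈ Set.Icc (7 / 6 : ℝ) (3 / 2) ∧ ∃ C : ℝ, 0 < C ∧ ∀ n : ℕ, 1 ≤ n →
      -- the left-to-right resistance
      (ENNReal.ofReal (C⁻¹ * ρ ^ n) ≤ SC.resLR n ∧ SC.resLR n ≤ ENNReal.ofReal (C * ρ ^ n)) ∧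
      -- adjacent boundary points; `i + 1` is taken modulo 8
      (∀ i j : Fin 8, SC.resV n (SC.ptV n i) (SC.ptV n (i + 1)) =
        SC.resV n (SC.ptV n j) (SC.ptV n (j + 1))) ∧
      (∀ i : Fin 8,
        ENNReal.ofReal (C⁻¹ * ρ ^ n) ≤ SC.resV n (SC.ptV n i) (SC.ptV n (i + 1)) ∧
        SC.resV n (SC.ptV n i) (SC.ptV n (i + 1)) ≤ ENNReal.ofReal (C * ρ ^ n)) ∧
      -- the cell graph; `i + 1` is taken modulo 8
      (∀ i j : Fin 8, SC.resW n (SC.constWord n i) (SC.constWord n (i + 1)) =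
        SC.resW n (SC.constWord n j) (SC.constWord n (j + 1))) ∧
      (∀ i : Fin 8,
        ENNReal.ofReal (C⁻¹ * ρ ^ n) ≤ SC.resW n (SC.constWord n i) (SC.constWord n (i + 1)) ∧
        SC.resW n (SC.constWord n i) (SC.constWord n (i + 1)) ≤ ENNReal.ofReal (C * ρ ^ n)) ∧
      -- all pairwise resistances
      (∀ p q : SC.V n, SC.resV n p q ≤ ENNReal.ofReal (C * ρ ^ n)) ∧
      (∀ w w' : SC.W n, SC.resW n w w' ≤ ENNReal.ofReal (C * ρ ^ n)) := by
  obtain ⟨ρ, hρ, hrate⟩ := SC.exists_conductance_rate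
  have hρ1 : 1 < ρ := by linarith [hρ.1]
  have hρ0 : 0 < ρ := by linarith
  have hinv : ∀ n, (SC.conductance n)⁻¹ ≤ 60 * ρ ^ n := fun n => by
    rw [← one_div, div_le_iff₀ (SC.conductance_pos n)]
    have := (hrate n).1
    linarith
  obtain ⟨c, hc, hbound⟩ := SC.exists_isResBound_pow hρ1 (by norm_num) hinv
  -- The second term dominates the comparison with words; `10 ^ 10` exceeds `552960 * 13824`, needed
  -- for the lower bounds, as well as 60 and 96.
  set C : ℝ := 10 ^ 10 + 13824 * c
  have hC10 : (10 : ℝ) ^ 10 ≤ C := by linarith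
  have hC : 0 < C := by linarith
  refine ⟨ρ, hρ, C, hC, fun n hn => ?_⟩
  have hpow : 1 ≤ ρ ^ n := one_le_pow₀ hρ1.le
  have hcpow : 0 < c * ρ ^ n := by positivity
  have hlow : 0 < C⁻¹ * ρ ^ n := by positivity
  have hV : ∀ p q : SC.V n, SC.resV n p q ≤ ENNReal.ofReal (C * ρ ^ n) := fun p q =>
    (SC.resV_le_ofReal hcpow (hbound n) p q).trans (ENNReal.ofReal_le_ofReal
      (mul_le_mul_of_nonneg_right (by linarith) (by positivity)))
  have hW : ∀ w w' : SC.W n, SC.resW n w w' ≤ ENNReal.ofReal (C * ρ ^ n) := fun w w' =>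
    (SC.resW_le_ofReal hcpow (hbound n) w w').trans (ENNReal.ofReal_le_ofReal (by
      have : C * ρ ^ n = 10 ^ 10 * ρ ^ n + 13824 * (c * ρ ^ n) := by ring
      linarith))
  obtain ⟨m, rfl⟩ := Nat.exists_eq_add_of_le' hn
  -- Separating functions at level `m + 1` are measured by the conductance at level `m`; the shift
  -- costs `ρ ≤ 3/2`, and `9216 * 3/2 = 13824`.
  have hm : SC.conductance m * ρ ^ (m + 1) ≤ 13824 := by
    have h1 := (hrate m).2
    have h2 : 0 ≤ SC.conductance m * ρ ^ m :=
      mul_nonneg (SC.conductance_pos m).le (by positivity)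
    rw [pow_succ, ← mul_assoc]
    nlinarith [hρ.2]
  have hsmall : ∀ K x : ℝ, K * x ≤ 10 ^ 10 → K * (C⁻¹ * x) ≤ 1 := fun K x h => by
    rw [mul_left_comm, ← div_eq_inv_mul, div_le_one hC]
    linarith
  refine ⟨⟨SC.ofReal_le_resLR hlow ?_, SC.resLR_le_ofReal (by positivity) ?_⟩,
    SC.resV_adjacent_eq _, fun i => ⟨SC.ofReal_le_resV_adjacent hlow ?_ i, hV _ _⟩,
    SC.resW_adjacent_eq _, fun i => ⟨SC.ofReal_le_resW_adjacent hlow ?_ i, hW _ _⟩, hV, hW⟩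
  · refine hsmall _ _ ?_
    linarith [(hrate (m + 1)).2]
  · have h1 := (hrate (m + 1)).1
    have h2 : 0 ≤ SC.conductance (m + 1) * ρ ^ (m + 1) := by linarith
    have h3 := mul_le_mul_of_nonneg_right hC10 h2
    linarith
  · refine hsmall _ _ ?_
    linarith
  · refine hsmall _ _ ?_
    linarith
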